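/- Let $M$ be a compact connected (non-empty, boundaryless) smooth Riemannian manifold, $\operatorname{dist}$ the Riemannian distance and $m$ the normalized Riemannian volume (Lebesgue measure). Let $f:M\to M$ be continuous, let $\mathcal S\subset M$ be a (possibly empty) compact submanifold all of whose components have dimension smaller than $\dim M$, and suppose that $f$ is a $C^2$ local diffeomorphism at every point of $M\setminus\mathcal S$. Suppose that $\mathcal S$ is a non-degenerate exceptional set for $f$: there are constants $B>1$ and $\beta>0$ such that (when $\mathcal S\neq\emptyset$; there is no condition when $\mathcal S=\emptyset$) (s1) $\frac1B\operatorname{dist}(x,\mathcal S)^{\beta}\le \frac{\|Df(x)v\|}{\|v\|}\le B\operatorname{dist}(x,\mathcal S)^{-\beta}$ for all $x\in M\setminus\mathcal S$ and $0\ne v\in T_xM$, and for all $x,y\in M\setminus\mathcal S$ with $\operatorname{dist}(x,y)<\operatorname{dist}(x,\mathcal S)/2$ (s2) $\bigl|\log\|Df(x)^{-1}\|-\log\|Df(y)^{-1}\|\bigr|\le \frac{B}{\operatorname{dist}(x,\mathcal S)^{\beta}}\operatorname{dist}(x,y)$, (s3) $\bigl|\log|\det Df(x)|-\log|\det Df(y)|\bigr|\le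 \frac{B}{\operatorname{dist}(x,\mathcal S)^{\beta}}\operatorname{dist}(x,y)$. Fix $0<b<\min\{1/2,1/(4\beta)\}$. For $\delta>0$ let $\operatorname{dist}_\delta(x,\mathcal S)=\operatorname{dist}(x,\mathcal S)$ if $\mathcal S\ne\emptyset$ and $\operatorname{dist}(x,\mathcal S)\le\delta$, and $\operatorname{dist}_\delta(x,\mathcal S)=1$ otherwise. For $0<\sigma<1$ and $\delta>0$, an integer $n\ge 1$ is a $(\sigma,\delta)$-hyperbolic time for $x\in M$ if for all $1\le k\le n$ $$\prod_{j=n-k}^{n-1}\|Df(f^j(x))^{-1}\|\le\sigma^k\quad\text{and}\quad \operatorname{dist}_\delta(f^{n-k}(x),\mathcal S)\ge\sigma^{bk}.$$ Suppose that for some $0<\sigma<1$ and $\delta>0$, $m$-almost every $x\in M$ has a $(\sigma,\delta)$-hyperbolic time, and that the map $h$ assigning to $x$ its first $(\sigma,\delta)$-hyperbolic time is Lebesgue integrable, $h\in L^1(m)$. Then $f$ has an invariant Borel probability measure that is absolutely continuous with respect to $m$. Moreover, every weak* accumulation point of the sequence $$\mu_n=\frac1n\sum_{j=0}^{n-1}f^j_*m$$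 is absolutely continuous with respect to $m$. -/

import Mathlib

open scoped Manifold ContDiff Bundle
open MeasureTheory Filter Bundle

noncomputable section

namespace HyperbolicTimes

/-- The absolute value of the determinant of a linear map `L` between Euclidean vector spaces of the
same finite dimension, computed in orthonormal bases: the square root of the Gram determinant
`det ⟪L bᵢ, L bⱼ⟫` for an orthonormal basis `b` of the source. -/
def absDet {V W : Type*} [NormedAddCommGroup V] [InnerProductSpace ℝ V] [FiniteDimensional ℝ V]
    [NormedAddCommGroup W] [InnerProductSpace ℝ W] (L : V →ₗ[ℝ] W) : ℝ :=
  √(Matrix.det (Matrix.of fun i j =>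
    inner ℝ (L (stdOrthonormalBasis ℝ V i)) (L (stdOrthonormalBasis ℝ V j))))

section Volume

variable {d : ℕ} (M : Type*) [TopologicalSpace M] [ChartedSpace (EuclideanSpace ℝ (Fin d)) M]
  [RiemannianBundle (fun x : M => TangentSpace (𝓡 d) x)]

variable {M} in
/-- The volume density `√(det gᵢⱼ)` of the Riemannian metric, read in the chart around `x`,
at the point `y` of the target of that chart. -/
def chartDensity (x : M) (y : EuclideanSpace ℝ (Fin d)) : ℝ :=
  absDet (V := EuclideanSpace ℝ (Fin d)) (W := TangentSpace (𝓡 d) ((chartAt _ x).symm y))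
    (mfderiv (𝓡 d) (𝓡 d) (chartAt (EuclideanSpace ℝ (Fin d)) x).symm y).toLinearMap

variable [MeasurableSpace M]

variable {M} in
/-- The Riemannian volume restricted to the domain of the chart around `x`: the measure
`√(det gᵢⱼ) dy` on the target of the chart, transported to `M`. -/
def chartVolume (x : M) : Measure M :=
  (((volume : Measure (EuclideanSpace ℝ (Fin d))).restrict
      (chartAt (EuclideanSpace ℝ (Fin d)) x).target).withDensity
        (fun y => ENNReal.ofReal (chartDensity x y))).map
    (chartAt (EuclideanSpace ℝ (Fin d)) x).symm

variable (d) in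
/-- The Riemannian volume measure of `M`: the smallest measure that dominates the volume of each
chart domain. -/
def riemannianVolume : Measure M := ⨆ x : M, chartVolume (d := d) x

variable (d) in
/-- Lebesgue measure on `M`: the normalized Riemannian volume. -/
def lebesgue : Measure M := (riemannianVolume d M Set.univ)⁻¹ • riemannianVolume d M

end Volume

section Dynamics

variable {d : ℕ} {M : Type*} [MetricSpace M] [ChartedSpace (EuclideanSpace ℝ (Fin d)) M]

variable (d) in
/-- `S` is a compact (embedded, smooth) submanifold of `M`, all of whose components have dimension
smaller than `d = dim M`: around each of its points `S` is a coordinate slice in some smooth chart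
of `M`. The empty set is allowed. -/
structure IsCompactProperSubmanifold (S : Set M) : Prop where
  isCompact : IsCompact S
  exists_slice_chart : ∀ p ∈ S, ∃ k < d, ∃ e ∈ IsManifold.maximalAtlas (𝓡 d) ∞ M,
    p ∈ e.source ∧ ∀ q ∈ e.source, q ∈ S ↔ ∀ i : Fin d, k ≤ (i : ℕ) → e q i = 0

variable [RiemannianBundle (fun x : M => TangentSpace (𝓡 d) x)]

variable (d) in
/-- `‖Df(x)⁻¹‖`, the operator norm (for the Riemannian norms) of the inverse of the derivative. -/
def normDerivInv (f : M → M) (x : M) : ℝ :=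
  ‖(mfderiv (𝓡 d) (𝓡 d) f x).inverse‖

variable (d) in
/-- `|det Df(x)|`, computed with the Riemannian metric. -/
def absDetDeriv (f : M → M) (x : M) : ℝ :=
  haveI : FiniteDimensional ℝ (TangentSpace (𝓡 d) x) :=
    inferInstanceAs (FiniteDimensional ℝ (EuclideanSpace ℝ (Fin d)))
  absDet (V := TangentSpace (𝓡 d) x) (W := TangentSpace (𝓡 d) (f x))
    (mfderiv (𝓡 d) (𝓡 d) f x).toLinearMap

variable (d) in
/-- The non-degeneracy conditions on the exceptional set `S` of `f`, with constants `B` and `β`.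
For `S = ∅` there is no distance to `S`, and the three conditions are void. -/
structure IsNondegenerate (f : M → M) (S : Set M) (B β : ℝ) : Prop where
  one_lt : 1 < B
  pos : 0 < β
  power_law : S.Nonempty → ∀ x ∉ S, ∀ v : TangentSpace (𝓡 d) x, v ≠ 0 →
    1 / B * Metric.infDist x S ^ β ≤ ‖mfderiv (𝓡 d) (𝓡 d) f x v‖ / ‖v‖ ∧
    ‖mfderiv (𝓡 d) (𝓡 d) f x v‖ / ‖v‖ ≤ B * Metric.infDist x S ^ (-β)
  norm_lipschitz : S.Nonempty → ∀ x ∉ S, ∀ y ∉ S, dist x y < Metric.infDist x S / 2 →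
    |Real.log (normDerivInv d f x) - Real.log (normDerivInv d f y)| ≤
      B / Metric.infDist x S ^ β * dist x y
  det_lipschitz : S.Nonempty → ∀ x ∉ S, ∀ y ∉ S, dist x y < Metric.infDist x S / 2 →
    |Real.log (absDetDeriv d f x) - Real.log (absDetDeriv d f y)| ≤
      B / Metric.infDist x S ^ β * dist x y

open scoped Classical in
/-- The `δ`-truncated distance from `x` to `S`; it is `1` when `S = ∅`. -/
def truncDist (δ : ℝ) (S : Set M) (x : M) : ℝ :=
  if S.Nonempty ∧ Metric.infDist x S ≤ δ then Metric.infDist x S else 1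

variable (d) in
/-- `n` is a `(σ, δ)`-hyperbolic time for `x` (with respect to the fixed exponent `b`). -/
def IsHyperbolicTime (f : M → M) (S : Set M) (b σ δ : ℝ) (n : ℕ) (x : M) : Prop :=
  ∀ k : ℕ, 1 ≤ k → k ≤ n →
    ∏ j ∈ Finset.Ico (n - k) n, normDerivInv d f (f^[j] x) ≤ σ ^ k ∧
    σ ^ (b * k) ≤ truncDist δ S (f^[n - k] x)

variable (d) in
/-- The first `(σ, δ)`-hyperbolic time of `x` (a positive integer); the value is `0` if there is no
such time. -/
def firstHyperbolicTime (f : M → M) (S : Set M) (b σ δ : ℝ) (x : M) : ℕ :=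
  sInf {n : ℕ | 1 ≤ n ∧ IsHyperbolicTime d f S b σ δ n x}

end Dynamics

section Averages

variable {M : Type*} [TopologicalSpace M] [MeasurableSpace M]

/-- The average `(1/n) ∑_{j<n} f^j_* m` of the push-forwards of `m`. -/
def averagedPushforward (f : M → M) (m : Measure M) (n : ℕ) : Measure M :=
  (n : ENNReal)⁻¹ • ∑ j ∈ Finset.range n, m.map f^[j]

/-- `μ` is a weak* accumulation point of the sequence `ν` of measures on the compact space `M`:
some subsequence converges to `μ` when tested against every continuous function. -/
def IsWeakStarAccumulationPoint (ν : ℕ → Measure M) (μ : Measure M) : Prop :=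
  ∃ φ : ℕ → ℕ, StrictMono φ ∧ ∀ g : C(M, ℝ),
    Tendsto (fun k => ∫ x, g x ∂(ν (φ k))) atTop (nhds (∫ x, g x ∂μ))

end Averages

end HyperbolicTimes

end

/-!
Write `m` for Lebesgue measure and `H n` for the set of points for which `n` is a hyperbolic time.
The heart of the argument is a uniform bound on densities
(`exists_measure_hyperbolicTime_inter_preimage_le`): there is a constant `C` with
`m (H n ∩ f^[n] ⁻¹' A) ≤ C * m A` for all `n` and all measurable `A`.

*Why the densities are bounded.* Put `q = σ ^ (1 / 4)`. If `n` is a hyperbolic time of `x`, then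
`f^[n - k] x` is at distance at least of order `σ ^ (b k)` from the exceptional set. The
non-degeneracy conditions and `b < 1 / 2`, `b β < 1 / 4` then control the derivative on the ball of
radius `r σ ^ (k / 2)` around that point: `‖Df⁻¹‖` grows by a factor of at most `σ ^ (-1 / 2)`, and
`log |det Df|` oscillates by at most a multiple of `q ^ k` (`exists_uniform_control`; compactness
replaces non-degeneracy if the exceptional set is empty). Short paths ending at `f^[n] x` can
therefore be lifted through `f^[n]`: as long as a partial lift is that close to the orbit of `x`, it
is contracted by `σ ^ (k / 2)` at time `n - k`, and so it remains that close
(`dist_iterate_le_of_lift`). Lifting the segments of a small chart ball `U` around `f^[n] x` gives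
an inverse branch of `f^[n]` over `U` (`exists_continuous_section`, `exists_inverse_branch`). The
oscillations of `log |det Df|` along a branch sum to a constant independent of `n`, so `f^[n]` has
bounded distortion on the branch (`measure_branch_mul_le`). Distinct branches over the connected
set `U` have disjoint open images, which can be summed (`measure_inter_preimage_mul_le`), and
finitely many `U` cover the manifold.

*From bounded densities to invariant measures.* A hyperbolic time of `f^[n] x`, added to a
hyperbolic time `n` of `x`, is a hyperbolic time of `x` (`IsHyperbolicTime.add`). Hence, if `n` is
the last hyperbolic time of `x` up to `j`, then `f^[n] x` belongs to the set `G (j - n)` of points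
that have no hyperbolic time in `1, …, j - n`. Integrability of the first hyperbolic time says that
`∑ m (G k)` is finite. So all the push-forwards of `m` under the iterates of `f` are dominated by
the single finite measure `C • ∑ (f^[k])_* (m|_{G k})`, which is absolutely continuous because `f`
is non-singular (`exists_finite_dominating_measure`). The domination passes to the averages and to
their weak limits (`absolutelyContinuous_of_tendsto_integral`), and any limit of the averages along
an ultrafilter is invariant (`exists_invariant_of_map_iterate_le`).

The volume and the determinant are defined through the Riemannian metric, so the change of variables
formula is first proved in pairs of charts (`chartVolume_image`) and then glued.
-/

namespace HyperbolicTimes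

local notation "𝔼(" n ")" => EuclideanSpace ℝ (Fin n)

/-! ### The determinant of a linear map between Euclidean spaces -/

section AbsDet

variable {ι V W X : Type*} [Fintype ι] [DecidableEq ι]
  [NormedAddCommGroup V] [InnerProductSpace ℝ V] [FiniteDimensional ℝ V]
  [NormedAddCommGroup W] [InnerProductSpace ℝ W] [FiniteDimensional ℝ W]
  [NormedAddCommGroup X] [InnerProductSpace ℝ X] [FiniteDimensional ℝ X]

lemma gram_eq_toMatrix_adjoint_comp (b : OrthonormalBasis ι ℝ V) (L : V →ₗ[ℝ] W) :
    Matrix.of (fun i j => inner ℝ (L (b i)) (L (b j))) =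
      LinearMap.toMatrix b.toBasis b.toBasis (LinearMap.adjoint L ∘ₗ L) := by
  ext i j
  rw [LinearMap.toMatrix_apply]
  simp [OrthonormalBasis.repr_apply_apply, LinearMap.adjoint_inner_right]

/-- The Gram determinant is the determinant of `L* L`, so it can be computed in any orthonormal
basis. -/
lemma absDet_eq_sqrt_gram (b : OrthonormalBasis ι ℝ V) (L : V →ₗ[ℝ] W) :
    absDet L = √(Matrix.det (Matrix.of fun i j => inner ℝ (L (b i)) (L (b j)))) := by
  rw [absDet, gram_eq_toMatrix_adjoint_comp, gram_eq_toMatrix_adjoint_comp,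
    LinearMap.det_toMatrix, LinearMap.det_toMatrix]

lemma absDet_eq_abs_det_toMatrix (b : OrthonormalBasis ι ℝ V) (c : OrthonormalBasis ι ℝ W)
    (L : V →ₗ[ℝ] W) :
    absDet L = |(LinearMap.toMatrix b.toBasis c.toBasis L).det| := by
  rw [absDet_eq_sqrt_gram b, gram_eq_toMatrix_adjoint_comp,
    LinearMap.toMatrix_comp _ c.toBasis, LinearMap.toMatrix_adjoint, Matrix.det_mul,
    Matrix.det_conjTranspose, star_trivial, Real.sqrt_mul_self_eq_abs]

lemma absDet_end (A : V →ₗ[ℝ] V) : absDet A = |LinearMap.det A| := by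
  rw [absDet_eq_abs_det_toMatrix (stdOrthonormalBasis ℝ V) (stdOrthonormalBasis ℝ V),
    LinearMap.det_toMatrix]

lemma absDet_comp (hVW : Module.finrank ℝ V = Module.finrank ℝ W)
    (hWX : Module.finrank ℝ W = Module.finrank ℝ X) (L : W →ₗ[ℝ] X) (A : V →ₗ[ℝ] W) :
    absDet (L ∘ₗ A) = absDet L * absDet A := by
  have b := stdOrthonormalBasis ℝ V
  have c := (stdOrthonormalBasis ℝ W).reindex (finCongr hVW.symm)
  have e := (stdOrthonormalBasis ℝ X).reindex (finCongr (hVW.trans hWX).symm)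
  rw [absDet_eq_abs_det_toMatrix b e, absDet_eq_abs_det_toMatrix c e,
    absDet_eq_abs_det_toMatrix b c, LinearMap.toMatrix_comp _ c.toBasis, Matrix.det_mul, abs_mul]

lemma absDet_pos_of_leftInverse (hVW : Module.finrank ℝ V = Module.finrank ℝ W)
    (L : V →ₗ[ℝ] W) (A : W →ₗ[ℝ] V) (h : A ∘ₗ L = LinearMap.id) : 0 < absDet L := by
  refine (show 0 ≤ absDet L from Real.sqrt_nonneg _).lt_of_ne fun h0 => ?_
  have h1 := absDet_comp hVW hVW.symm A L
  rw [h, absDet_end, ← h0] at h1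
  simp at h1

end AbsDet

/-! ### Weak limits of dominated measures and invariance -/

section WeakLimits

variable {M : Type*} [MeasurableSpace M]

lemma averagedPushforward_le {f : M → M} {m θ : Measure M} (h : ∀ j, m.map f^[j] ≤ θ) (n : ℕ) :
    averagedPushforward f m n ≤ θ := by
  refine Measure.le_iff.2 fun A _ => ?_
  simp only [averagedPushforward, Measure.smul_apply, Measure.finsetSum_apply, smul_eq_mul]
  calc (n : ENNReal)⁻¹ * ∑ j ∈ Finset.range n, m.map f^[j] A
      ≤ (n : ENNReal)⁻¹ * ∑ j ∈ Finset.range n, θ A := by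
        gcongr with j _
        exact h j
    _ = ((n : ENNReal)⁻¹ * n) * θ A := by simp [mul_assoc]
    _ ≤ 1 * θ A := by gcongr; exact ENNReal.inv_mul_le_one _
    _ = θ A := one_mul _

variable [TopologicalSpace M] [BorelSpace M]

lemma isProbabilityMeasure_averagedPushforward {f : M → M} (hf : Continuous f) (m : Measure M)
    [IsProbabilityMeasure m] {n : ℕ} (hn : n ≠ 0) :
    IsProbabilityMeasure (averagedPushforward f m n) := by
  constructor
  have h : ∀ j, m.map f^[j] Set.univ = 1 := fun j => by
    rw [Measure.map_apply (hf.iterate j).measurable MeasurableSet.univ, Set.preimage_univ,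
      measure_univ]
  simp only [averagedPushforward, Measure.smul_apply, Measure.finsetSum_apply, h, smul_eq_mul,
    Finset.sum_const, Finset.card_range, nsmul_eq_mul, mul_one]
  exact ENNReal.inv_mul_cancel (by exact_mod_cast hn) (ENNReal.natCast_ne_top n)

end WeakLimits

section CompactSpace

variable {M : Type*} [MetricSpace M] [CompactSpace M] [MeasurableSpace M] [BorelSpace M]

lemma integrable_continuousMap (μ : Measure M) [IsFiniteMeasure μ] (g : C(M, ℝ)) :
    Integrable g μ :=
  (BoundedContinuousFunction.mkOfCompact g).integrable μ

/-- A weak limit of measures dominated by a fixed finite measure is absolutely continuous with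
respect to it. -/
lemma absolutelyContinuous_of_tendsto_integral {ι : Type*} {l : Filter ι} [l.NeBot]
    {ν : ι → Measure M} {θ μ : Measure M} [IsFiniteMeasure θ] [IsFiniteMeasure μ]
    (hν : ∀ᶠ i in l, ν i ≤ θ)
    (hlim : ∀ g : C(M, ℝ), Tendsto (fun i => ∫ x, g x ∂(ν i)) l (nhds (∫ x, g x ∂μ))) :
    μ ≪ θ := by
  have hint : ∀ g : C(M, ℝ), 0 ≤ g → ∫ x, g x ∂μ ≤ ∫ x, g x ∂θ := fun g hg => by
    refine le_of_tendsto (hlim g) (hν.mono fun i hi => ?_)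
    exact integral_mono_measure hi (Eventually.of_forall hg) (integrable_continuousMap θ g)
  have hclosed : ∀ F : Set M, IsClosed F → μ F ≤ θ F := fun F hF => by
    obtain ⟨u, -, hu0, hu⟩ := exists_seq_strictAnti_tendsto (0 : ℝ)
    have h1 := tendsto_integral_thickenedIndicator_of_isClosed μ hF hu0 hu
    have h2 := tendsto_integral_thickenedIndicator_of_isClosed θ hF hu0 hu
    have h3 : μ.real F ≤ θ.real F := le_of_tendsto_of_tendsto' h1 h2 fun n =>
      hint ⟨fun x => (thickenedIndicator (hu0 n) F x : ℝ),
        NNReal.continuous_coe.comp (thickenedIndicator (hu0 n) F).continuous⟩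
        (fun x => NNReal.coe_nonneg _)
    rwa [Measure.real, Measure.real, ENNReal.toReal_le_toReal (measure_ne_top _ _)
      (measure_ne_top _ _)] at h3
  refine Measure.AbsolutelyContinuous.mk fun A hA hA0 => ?_
  rw [hA.measure_eq_iSup_isClosed_of_ne_top (measure_ne_top μ A)]
  simp only [ENNReal.iSup_eq_zero]
  exact fun F hFA hF => le_antisymm ((hclosed F hF).trans ((measure_mono hFA).trans hA0.le)) bot_le

lemma integral_averagedPushforward {f : M → M} (hf : Continuous f) (m : Measure M)
    [IsProbabilityMeasure m] (n : ℕ) (g : C(M, ℝ)) :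
    ∫ x, g x ∂(averagedPushforward f m n) =
      (n : ℝ)⁻¹ * ∑ j ∈ Finset.range n, ∫ x, g (f^[j] x) ∂m := by
  have hfin : ∀ j, IsFiniteMeasure (m.map f^[j]) := fun j => inferInstance
  rw [averagedPushforward, integral_smul_measure,
    integral_finsetSum_measure fun j _ => integrable_continuousMap _ g, ENNReal.toReal_inv,
    ENNReal.toReal_natCast, smul_eq_mul]
  congr 1
  refine Finset.sum_congr rfl fun j _ => ?_
  rw [integral_map (hf.iterate j).measurable.aemeasurable
    g.continuous.aestronglyMeasurable]

/-- If all push-forwards of `m` under the iterates of a continuous map are dominated by one finite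
measure `θ`, then there is an invariant probability measure absolutely continuous with respect to
`θ`: any limit of the averaged push-forwards. -/
lemma exists_invariant_of_map_iterate_le {f : M → M} (hf : Continuous f) {m θ : Measure M}
    [IsProbabilityMeasure m] [IsFiniteMeasure θ] (h : ∀ j, m.map f^[j] ≤ θ) :
    ∃ μ : Measure M, IsProbabilityMeasure μ ∧ MeasurePreserving f μ μ ∧ μ ≪ θ := by
  let ν : ℕ → ProbabilityMeasure M := fun n =>
    ⟨averagedPushforward f m (n + 1), isProbabilityMeasure_averagedPushforward hf m n.succ_ne_zero⟩
  let U : Ultrafilter ℕ := Ultrafilter.of atTop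
  have hU : (U : Filter ℕ) ≤ atTop := Ultrafilter.of_le atTop
  obtain ⟨μ, -, hμ⟩ := isCompact_univ.ultrafilter_le_nhds (U.map ν) (by simp)
  have hμ' : Tendsto ν U (nhds μ) := hμ
  have hlim : ∀ g : C(M, ℝ), Tendsto (fun n => ∫ x, g x ∂(averagedPushforward f m (n + 1))) U
      (nhds (∫ x, g x ∂(μ : Measure M))) := fun g =>
    ProbabilityMeasure.tendsto_iff_forall_integral_tendsto.1 hμ'
      (BoundedContinuousFunction.mkOfCompact g)
  refine ⟨μ, inferInstance, ⟨hf.measurable, ?_⟩, absolutelyContinuous_of_tendsto_integral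
    (Eventually.of_forall fun n => averagedPushforward_le h (n + 1)) hlim⟩
  have : IsFiniteMeasure ((μ : Measure M).map f) := inferInstance
  refine ext_of_forall_integral_eq_of_IsFiniteMeasure fun g => ?_
  rw [integral_map hf.measurable.aemeasurable g.continuous.aestronglyMeasurable]
  have h1 := hlim ⟨g, g.continuous⟩
  have h2 := hlim ⟨fun x => g (f x), g.continuous.comp hf⟩
  -- the two averages differ by the boundary terms `j = 0` and `j = n + 1` only
  have h3 : Tendsto (fun n : ℕ => ∫ x, g (f x) ∂(averagedPushforward f m (n + 1)) -
      ∫ x, g x ∂(averagedPushforward f m (n + 1))) U (nhds 0) := by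
    refine Tendsto.mono_left ?_ hU
    have hb : ∀ n : ℕ, ‖∫ x, g (f x) ∂(averagedPushforward f m (n + 1)) -
        ∫ x, g x ∂(averagedPushforward f m (n + 1))‖ ≤ 2 * ‖g‖ * (1 / ((n : ℝ) + 1)) := fun n => by
      have e1 := integral_averagedPushforward hf m (n + 1) ⟨g, g.continuous⟩
      have e2 := integral_averagedPushforward hf m (n + 1) ⟨fun x => g (f x), g.continuous.comp hf⟩
      simp only [ContinuousMap.coe_mk] at e1 e2
      have e3 : ∀ j, (fun x => g (f (f^[j] x))) = fun x => g (f^[j + 1] x) := fun j => by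
        funext x; rw [Function.iterate_succ_apply']
      simp only [e3] at e2
      have hn : ∀ j, |∫ x, g (f^[j] x) ∂m| ≤ ‖g‖ := fun j => by
        refine (norm_integral_le_of_norm_le_const (C := ‖g‖)
          (Eventually.of_forall fun x => g.norm_coe_le_norm _)).trans ?_
        simp
      rw [e1, e2, ← mul_sub, ← Finset.sum_sub_distrib, Finset.sum_range_sub
        (fun j => ∫ x, g (f^[j] x) ∂m), norm_mul, Real.norm_eq_abs, Real.norm_eq_abs, abs_inv,
        mul_comm]
      have hpos : (0 : ℝ) < (n : ℝ) + 1 := by positivity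
      rw [Nat.cast_add_one, abs_of_pos hpos, one_div]
      gcongr
      refine (abs_sub _ _).trans ?_
      linarith [hn (n + 1), hn 0]
    refine squeeze_zero_norm hb ?_
    simpa using tendsto_one_div_add_atTop_nhds_zero_nat.const_mul (2 * ‖g‖)
  have h4 := tendsto_nhds_unique h3 (h2.sub h1)
  simp only [ContinuousMap.coe_mk] at h4
  linarith

end CompactSpace

/-! ### Domination of the push-forwards by a finite measure -/

section Domination

variable {M : Type*} [MeasurableSpace M]

/-- Let `H n` be sets on which the density of the `n`-th push-forward of `m` is uniformly bounded,
and suppose that every orbit segment `x, …, f^j x` contains a last point `f^n x` with `x ∈ H n`,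
and that `f^n x` then belongs to `G (j - n)`. If the measures of the sets `G k` are summable, then
all push-forwards are dominated by one finite measure, a multiple of the sum of the push-forwards
under `f^[k]` of `m` restricted to `G k`. -/
lemma exists_finite_dominating_measure {f : M → M} {m : Measure M}
    (hf : Measurable f) (hns : m.map f ≪ m) (H G : ℕ → Set M)
    (hcover : ∀ j x, ∃ n ≤ j, x ∈ H n ∧ f^[n] x ∈ G (j - n)) {C : ENNReal} (hC : C ≠ ⊤)
    (hH : ∀ n A, MeasurableSet A → m (H n ∩ f^[n] ⁻¹' A) ≤ C * m A)
    (hG : ∑' k, m (G k) ≠ ⊤) :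
    ∃ θ : Measure M, IsFiniteMeasure θ ∧ θ ≪ m ∧ ∀ j, m.map f^[j] ≤ θ := by
  -- `G k` need not be measurable; its measurable hull has the same measure
  let T : ℕ → Set M := fun k => toMeasurable m (G k)
  have hT : ∀ k, MeasurableSet (T k) := fun k => measurableSet_toMeasurable _ _
  let ν : ℕ → Measure M := fun k => (m.restrict (T k)).map f^[k]
  have hfm : ∀ k, Measurable f^[k] := fun k => hf.iterate k
  have hν : ∀ k A, MeasurableSet A → ν k A = m (T k ∩ f^[k] ⁻¹' A) := fun k A hA => by
    rw [Measure.map_apply (hfm k) hA, Measure.restrict_apply (hfm k hA), Set.inter_comm]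
  have hnsk : ∀ k, m.map f^[k] ≪ m := fun k => by
    induction k with
    | zero => simpa using Measure.AbsolutelyContinuous.rfl
    | succ k ih =>
      rw [Function.iterate_succ', ← Measure.map_map hf (hfm k)]
      exact (ih.map hf).trans hns
  refine ⟨C • Measure.sum ν, ⟨?_⟩, ?_, fun j => Measure.le_iff.2 fun A hA => ?_⟩
  · have h : ∀ k, ν k Set.univ = m (G k) := fun k => by
      rw [hν k _ MeasurableSet.univ, Set.preimage_univ, Set.inter_univ, measure_toMeasurable]
    rw [Measure.smul_apply, Measure.sum_apply _ MeasurableSet.univ, smul_eq_mul]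
    simp only [h]
    exact ENNReal.mul_lt_top hC.lt_top hG.lt_top
  · refine Measure.AbsolutelyContinuous.smul_left ?_ C
    refine Measure.absolutelyContinuous_sum_left fun k => ?_
    exact (Measure.restrict_le_self.absolutelyContinuous.map (hfm k)).trans (hnsk k)
  · rw [Measure.map_apply (hfm j) hA, Measure.smul_apply, Measure.sum_apply _ hA, smul_eq_mul]
    have hsub : f^[j] ⁻¹' A ⊆ ⋃ n ∈ Finset.range (j + 1),
        H n ∩ f^[n] ⁻¹' (T (j - n) ∩ f^[j - n] ⁻¹' A) := fun x hx => by
      obtain ⟨n, hn, hxH, hxG⟩ := hcover j x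
      simp only [Set.mem_iUnion, Finset.mem_range]
      refine ⟨n, by omega, hxH, subset_toMeasurable _ _ hxG, ?_⟩
      rw [Set.mem_preimage, ← Function.iterate_add_apply, Nat.sub_add_cancel hn]
      exact hx
    calc m (f^[j] ⁻¹' A)
        ≤ ∑ n ∈ Finset.range (j + 1), m (H n ∩ f^[n] ⁻¹' (T (j - n) ∩ f^[j - n] ⁻¹' A)) :=
          (measure_mono hsub).trans (measure_biUnion_finset_le _ _)
      _ ≤ ∑ n ∈ Finset.range (j + 1), C * ν (j - n) A := by
          gcongr with n _
          rw [hν _ A hA]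
          exact hH n _ ((hT _).inter (hfm _ hA))
      _ = ∑ k ∈ Finset.range (j + 1), C * ν k A :=
          Finset.sum_range_reflect (fun k => C * ν k A) (j + 1)
      _ ≤ C * ∑' k, ν k A := by
          rw [← Finset.mul_sum]
          gcongr
          exact ENNReal.sum_le_tsum _

end Domination

/-! ### Lifting of paths and local sections under an a priori bound -/

section Lifting

variable {X Y : Type*} [MetricSpace X] [MetricSpace Y]

/-- Near a compact set, the local inverses of a local homeomorphism are defined on balls of a uniform
radius. -/
lemma exists_uniform_local_section {F : X → Y} {K : Set X} (hK : IsCompact K)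
    (hF : IsLocalHomeomorphOn F K) :
    ∃ η > 0, ∀ y ∈ K, ∃ s : Y → X, ContinuousOn s (Metric.ball (F y) η) ∧ s (F y) = y ∧
      ∀ z ∈ Metric.ball (F y) η, F (s z) = z := by
  refine hK.induction_on (p := fun A => ∃ η > 0, ∀ y ∈ A, ∃ s : Y → X,
    ContinuousOn s (Metric.ball (F y) η) ∧ s (F y) = y ∧ ∀ z ∈ Metric.ball (F y) η, F (s z) = z)
    ⟨1, one_pos, by simp⟩ ?_ ?_ ?_
  · rintro A A' hA ⟨η, hη, h⟩
    exact ⟨η, hη, fun y hy => h y (hA hy)⟩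
  · rintro A A' ⟨η, hη, h⟩ ⟨η', hη', h'⟩
    refine ⟨min η η', lt_min hη hη', ?_⟩
    rintro y (hy | hy)
    · obtain ⟨s, hs, hsy, hs'⟩ := h y hy
      have hb := Metric.ball_subset_ball (x := F y) (min_le_left η η')
      exact ⟨s, hs.mono hb, hsy, fun z hz => hs' z (hb hz)⟩
    · obtain ⟨s, hs, hsy, hs'⟩ := h' y hy
      have hb := Metric.ball_subset_ball (x := F y) (min_le_right η η')
      exact ⟨s, hs.mono hb, hsy, fun z hz => hs' z (hb hz)⟩
  · intro y hy
    obtain ⟨e, hye, rfl⟩ := hF y hy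
    obtain ⟨ε, hε, hball⟩ := Metric.isOpen_iff.1 e.open_target (e y) (e.map_source hye)
    have hN : e.source ∩ e ⁻¹' Metric.ball (e y) (ε / 2) ∈ nhds y :=
      (e.isOpen_inter_preimage Metric.isOpen_ball).mem_nhds
        ⟨hye, Metric.mem_ball_self (half_pos hε)⟩
    refine ⟨_, mem_nhdsWithin_of_mem_nhds hN, ε / 2, half_pos hε, fun y' hy' => ?_⟩
    have hsub : Metric.ball (e y') (ε / 2) ⊆ e.target := fun z hz => by
      refine hball (Metric.mem_ball.2 ?_)
      have h1 := Metric.mem_ball.1 hz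
      have h2 := Metric.mem_ball.1 hy'.2
      linarith [dist_triangle z (e y') (e y)]
    exact ⟨e.symm, e.continuousOn_symm.mono hsub, e.left_inv hy'.1,
      fun z hz => e.right_inv (hsub hz)⟩

/-- A path lifts through a local homeomorphism as soon as all its partial lifts stay in a fixed
compact set. -/
lemma exists_path_lift {F : X → Y} {K : Set X} (hK : IsCompact K) (hF : IsLocalHomeomorphOn F K)
    {γ : ℝ → Y} (hγ : ContinuousOn γ (Set.Icc 0 1)) {x : X} (hx : F x = γ 0)
    (apriori : ∀ T ∈ Set.Icc (0 : ℝ) 1, ∀ c : ℝ → X, ContinuousOn c (Set.Icc 0 T) → c 0 = x →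
      (∀ t ∈ Set.Icc 0 T, F (c t) = γ t) → c T ∈ K) :
    ∃ c : ℝ → X, ContinuousOn c (Set.Icc 0 1) ∧ c 0 = x ∧ ∀ t ∈ Set.Icc 0 1, F (c t) = γ t := by
  obtain ⟨η, hη, hsec⟩ := exists_uniform_local_section hK hF
  obtain ⟨ε, hε, hunif⟩ := Metric.uniformContinuousOn_iff.1
    (isCompact_Icc.uniformContinuousOn_of_continuous hγ) η hη
  obtain ⟨N, hN⟩ := exists_nat_one_div_lt hε
  -- the path is lifted over `N + 1` intervals, each mapped into a ball that carries a local section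
  have hNpos : (0 : ℝ) < N + 1 := by positivity
  have step : ∀ i : ℕ, i ≤ N + 1 → ∃ c : ℝ → X, ContinuousOn c (Set.Icc 0 (i / (N + 1))) ∧
      c 0 = x ∧ ∀ t ∈ Set.Icc (0 : ℝ) (i / (N + 1)), F (c t) = γ t := by
    intro i
    induction i with
    | zero =>
      intro _
      refine ⟨fun _ => x, continuousOn_const, rfl, fun t ht => ?_⟩
      have : t = 0 := by simpa using ht
      rw [this, hx]
    | succ i ih =>
      intro hi
      obtain ⟨c, hc, hc0, hcF⟩ := ih (by omega)
      set a : ℝ := i / (N + 1) with ha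
      set b : ℝ := ((i + 1 : ℕ) : ℝ) / (N + 1) with hb
      have hab : b = a + 1 / (N + 1) := by rw [ha, hb]; push_cast; ring
      have hstep : 0 < 1 / ((N : ℝ) + 1) := by positivity
      have ha0 : 0 ≤ a := by positivity
      have hb1 : b ≤ 1 := by
        rw [hb, div_le_one hNpos]
        exact_mod_cast hi
      have haI : a ∈ Set.Icc (0 : ℝ) 1 := ⟨ha0, by linarith⟩
      obtain ⟨s, hs, hsa, hsF⟩ := hsec (c a) (apriori a haI c hc hc0 hcF)
      have hFa : F (c a) = γ a := hcF a ⟨ha0, le_rfl⟩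
      rw [hFa] at hs hsa hsF
      have hmem : ∀ t ∈ Set.Icc a b, γ t ∈ Metric.ball (γ a) η := fun t ht => by
        refine hunif t ⟨ha0.trans ht.1, ht.2.trans hb1⟩ a haI ?_
        rw [Real.dist_eq, abs_of_nonneg (by linarith [ht.1])]
        linarith [ht.2]
      have hunion : Set.Icc 0 b = Set.Icc 0 a ∪ Set.Icc a b :=
        (Set.Icc_union_Icc_eq_Icc ha0 (by linarith)).symm
      refine ⟨fun t => if t ≤ a then c t else s (γ t), ?_, by simp [ha0, hc0], ?_⟩
      · rw [hunion]
        refine ContinuousOn.union_of_isClosed ?_ ?_ isClosed_Icc isClosed_Icc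
        · exact hc.congr fun t ht => if_pos ht.2
        · refine (hs.comp (hγ.mono (Set.Icc_subset_Icc ha0 hb1)) hmem).congr fun t ht => ?_
          rcases ht.1.eq_or_lt with rfl | h
          · simp [hsa]
          · simp [not_le.2 h]
      · intro t ht
        by_cases h : t ≤ a
        · simpa [h] using hcF t ⟨ht.1, h⟩
        · simpa [h] using hsF _ (hmem t ⟨(not_le.1 h).le, ht.2⟩)
  obtain ⟨c, hc⟩ := step (N + 1) le_rfl
  have h1 : ((N + 1 : ℕ) : ℝ) / ((N : ℝ) + 1) = 1 := by
    push_cast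
    exact div_self hNpos.ne'
  rw [h1] at hc
  exact ⟨c, hc⟩

lemma isLocalHomeomorph_restrict {F : X → Y} {E : Set X} (hE : IsOpen E)
    (hF : IsLocalHomeomorphOn F E) : IsLocalHomeomorph (fun y : E => F y) :=
  isLocalHomeomorph_iff_isLocalHomeomorphOn_univ.2
    (hF.comp hE.isOpenEmbedding_subtypeVal.isLocalHomeomorph.isLocalHomeomorphOn
      fun y _ => y.2)

/-- If a set `U` contracts to `F x` along paths whose partial lifts starting at `x` stay in a
compact set on which `F` is a local homeomorphism, then `F` has a continuous section over `U` with
value `x` at `F x`. -/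
lemma exists_continuous_section {F : X → Y} {E K : Set X} (hE : IsOpen E)
    (hF : IsLocalHomeomorphOn F E) (hK : IsCompact K) (hKE : K ⊆ E) {x : X} {U : Set Y}
    (hxU : F x ∈ U) {H : ℝ → Y → Y}
    (hH : ContinuousOn (fun p : ℝ × Y => H p.1 p.2) (Set.Icc 0 1 ×ˢ U))
    (H0 : ∀ u ∈ U, H 0 u = F x) (H1 : ∀ u ∈ U, H 1 u = u)
    (Hx : ∀ t ∈ Set.Icc (0 : ℝ) 1, H t (F x) = F x)
    (apriori : ∀ u ∈ U, ∀ T ∈ Set.Icc (0 : ℝ) 1, ∀ c : ℝ → X, ContinuousOn c (Set.Icc 0 T) →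
      c 0 = x → (∀ t ∈ Set.Icc 0 T, F (c t) = H t u) → c T ∈ K) :
    ∃ s : Y → X, ContinuousOn s U ∧ (∀ u ∈ U, s u ∈ K ∧ F (s u) = u) ∧ s (F x) = x := by
  have hlift : ∀ u : U, ∃ c : ℝ → X, ContinuousOn c (Set.Icc 0 1) ∧ c 0 = x ∧
      ∀ t ∈ Set.Icc (0 : ℝ) 1, F (c t) = H t u := fun u =>
    exists_path_lift hK (hF.mono hKE)
      (hH.comp (f := fun t : ℝ => (t, (u : Y))) (by fun_prop) fun t ht => ⟨ht, u.2⟩)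
      (H0 u u.2).symm (apriori u u.2)
  choose c hc hc0 hcF using hlift
  have hcK : ∀ u : U, ∀ t ∈ Set.Icc (0 : ℝ) 1, c u t ∈ K := fun u t ht =>
    apriori u u.2 t ht (c u) ((hc u).mono (Set.Icc_subset_Icc_right ht.2)) (hc0 u)
      fun t' ht' => hcF u t' ⟨ht'.1, ht'.2.trans ht.2⟩
  let p : E → Y := fun y => F y
  have hp : IsLocalHomeomorph p := isLocalHomeomorph_restrict hE hF
  have hsep : IsSeparatedMap p := T2Space.isSeparatedMap p
  let h : C(unitInterval × U, Y) :=
    ⟨fun q => H q.1 q.2, hH.comp_continuous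
      (f := fun q : unitInterval × U => ((q.1 : ℝ), (q.2 : Y))) (by fun_prop) fun q => ⟨q.1.2, q.2.2⟩⟩
  let g : unitInterval × U → E := fun q => ⟨c q.2 q.1, hKE (hcK q.2 q.1 q.1.2)⟩
  have hgc : ∀ u : U, Continuous fun t : unitInterval => g (t, u) := fun u =>
    ((hc u).comp_continuous continuous_subtype_val fun t => t.2).subtype_mk _
  have hg : Continuous g := by
    refine hp.continuous_lift hsep h (funext fun q => hcF q.2 q.1 q.1.2) ?_ hgc
    refine Continuous.subtype_mk (f := fun u : U => c u ((0 : unitInterval) : ℝ)) ?_ _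
    simp only [Set.Icc.coe_zero, hc0]
    exact continuous_const
  classical
  refine ⟨fun u => if hu : u ∈ U then c ⟨u, hu⟩ 1 else x, ?_, fun u hu => ?_, ?_⟩
  · rw [continuousOn_iff_continuous_domRestrict]
    have : Continuous fun u : U => (g (1, u) : X) := by fun_prop
    refine this.congr fun u => ?_
    simp [g, Set.domRestrict_apply]
  · have h1 : (1 : ℝ) ∈ Set.Icc (0 : ℝ) 1 := ⟨zero_le_one, le_rfl⟩
    simp only [hu, dif_pos]
    exact ⟨hcK _ 1 h1, (hcF ⟨u, hu⟩ 1 h1).trans (H1 u hu)⟩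
  · simp only [hxU, dif_pos]
    have hxE : x ∈ E := hKE (by simpa [hc0] using hcK ⟨F x, hxU⟩ 0 ⟨le_rfl, zero_le_one⟩)
    -- over the point `F x` the contraction is constant, and so is its lift
    have heq := hsep.eq_of_comp_eq hp.isLocallyInjective (hgc ⟨F x, hxU⟩)
      (continuous_const (y := (⟨x, hxE⟩ : E)))
      (funext fun t => by
        change F (c ⟨F x, hxU⟩ t) = F x
        rw [hcF _ t t.2, Hx t t.2]) 0 (by ext; simp [g, hc0])
    have := congrArg Subtype.val (congrFun heq 1)
    simpa [g] using this

/-- Two sections over a connected set that agree at one point agree everywhere. -/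
lemma eqOn_section_of_eq {F : X → Y} {E : Set X} (hE : IsOpen E)
    (hF : IsLocalHomeomorphOn F E) {U : Set Y} (hU : IsPreconnected U) {s s' : Y → X}
    (hs : ContinuousOn s U) (hs' : ContinuousOn s' U) (hsE : ∀ u ∈ U, s u ∈ E)
    (hsE' : ∀ u ∈ U, s' u ∈ E) (hFs : ∀ u ∈ U, F (s u) = u) (hFs' : ∀ u ∈ U, F (s' u) = u)
    {a : Y} (ha : a ∈ U) (haa : s a = s' a) : Set.EqOn s s' U := by
  have hp := isLocalHomeomorph_restrict hE hF
  have := isPreconnected_iff_preconnectedSpace.1 hU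
  have hsep : IsSeparatedMap (fun y : E => F y) := T2Space.isSeparatedMap _
  have heq := hsep.eq_of_comp_eq hp.isLocallyInjective
    (g₁ := fun u : U => (⟨s u, hsE u u.2⟩ : E)) (g₂ := fun u : U => (⟨s' u, hsE' u u.2⟩ : E))
    ((hs.comp_continuous continuous_subtype_val fun u => u.2).subtype_mk _)
    ((hs'.comp_continuous continuous_subtype_val fun u => u.2).subtype_mk _)
    (funext fun u => (hFs u u.2).trans (hFs' u u.2).symm) ⟨a, ha⟩ (Subtype.ext haa)
  exact fun u hu => congrArg Subtype.val (congrFun heq ⟨u, hu⟩)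

lemma isOpen_image_section {F : X → Y} {E : Set X} (hE : IsOpen E)
    (hF : IsLocalHomeomorphOn F E) {U : Set Y} (hU : IsOpen U) {s : Y → X}
    (hs : ContinuousOn s U) (hsE : ∀ u ∈ U, s u ∈ E) (hFs : ∀ u ∈ U, F (s u) = u) :
    IsOpen (s '' U) := by
  have hp := isLocalHomeomorph_restrict hE hF
  have hopen : Topology.IsOpenEmbedding fun u : U => (⟨s u, hsE u u.2⟩ : E) :=
    hp.isOpenEmbedding_of_comp (by
      have : (fun y : E => F y) ∘ (fun u : U => (⟨s u, hsE u u.2⟩ : E)) = Subtype.val :=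
        funext fun u => hFs u u.2
      rw [this]
      exact hU.isOpenEmbedding_subtypeVal)
      ((hs.comp_continuous continuous_subtype_val fun u => u.2).subtype_mk _)
  have hr := (hE.isOpenEmbedding_subtypeVal.comp hopen).isOpen_range
  convert! hr
  ext y
  simp [Set.mem_image]

end Lifting

/-! ### Riemannian distance under differentiable maps -/

section RiemannianDistance

open scoped NNReal ENNReal
open Manifold

variable {E : Type*} [NormedAddCommGroup E] [NormedSpace ℝ E] {H : Type*} [TopologicalSpace H]
  {I : ModelWithCorners ℝ E H} {M : Type*} [PseudoEMetricSpace M] [ChartedSpace H M]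
  [RiemannianBundle (fun x : M => TangentSpace I x)] [IsRiemannianManifold I M]
  {E' : Type*} [NormedAddCommGroup E'] [NormedSpace ℝ E'] {H' : Type*} [TopologicalSpace H']
  {I' : ModelWithCorners ℝ E' H'} {M' : Type*} [PseudoEMetricSpace M'] [ChartedSpace H' M']
  [RiemannianBundle (fun x : M' => TangentSpace I' x)] [IsRiemannianManifold I' M']

/-- A map whose derivative is bounded by `K` on a ball contracts the distance to the center of the
ball by the factor `K`: map a nearly shortest path, which does not leave the ball. -/
lemma edist_le_mul_of_enorm_mfderiv_le [IsManifold I 1 M] [IsManifold I' 1 M'] {G : M → M'}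
    {O : Set M} (hO : IsOpen O) (hG : ContMDiffOn I I' 1 G O) {K : ℝ≥0}
    (hK : ∀ y ∈ O, ∀ v : TangentSpace I y, ‖mfderiv I I' G y v‖ₑ ≤ K * ‖v‖ₑ) {x y : M} {r : ℝ≥0∞}
    (hball : Metric.eball x r ⊆ O) (hxy : edist x y < r) :
    edist (G x) (G y) ≤ K * edist x y := by
  have key : ∀ r' ∈ Set.Ioo (edist x y) r, edist (G x) (G y) ≤ K * r' := fun r' hr' => by
    have hlt : riemannianEDist I x y < r' := by
      rw [← IsRiemannianManifold.out (I := I)]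
      exact hr'.1
    obtain ⟨γ, hγ0, hγ1, hγ, hlen, -, -⟩ :=
      exists_lt_locally_constant_of_riemannianEDist_lt hlt zero_lt_one
    have hmem : ∀ t ∈ Set.Icc (0 : ℝ) 1, γ t ∈ O := fun t ht => by
      refine hball ?_
      rw [Metric.mem_eball', IsRiemannianManifold.out (I := I)]
      calc riemannianEDist I x (γ t) ≤ pathELength I γ 0 t :=
            riemannianEDist_le_pathELength hγ.contMDiffOn hγ0 rfl ht.1
        _ ≤ pathELength I γ 0 1 := pathELength_mono le_rfl ht.2
        _ < r := hlen.trans hr'.2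
    have hGγ : ContMDiffOn (modelWithCornersSelf ℝ ℝ) I' 1 (G ∘ γ) (Set.Icc 0 1) :=
      hG.comp hγ.contMDiffOn hmem
    calc edist (G x) (G y) = riemannianEDist I' (G x) (G y) := IsRiemannianManifold.out _ _
      _ ≤ pathELength I' (G ∘ γ) 0 1 := riemannianEDist_le_pathELength hGγ
          (by simp [hγ0]) (by simp [hγ1]) zero_le_one
      _ ≤ K * pathELength I γ 0 1 := by
          rw [pathELength_eq_lintegral_mfderiv_Icc, pathELength_eq_lintegral_mfderiv_Icc,
            ← lintegral_const_mul' _ _ ENNReal.coe_ne_top]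
          refine setLIntegral_mono' measurableSet_Icc fun t ht => ?_
          have h1 : mfderiv (modelWithCornersSelf ℝ ℝ) I' (G ∘ γ) t =
              (mfderiv I I' G (γ t)).comp (mfderiv (modelWithCornersSelf ℝ ℝ) I γ t) :=
            mfderiv_comp t ((hG.contMDiffAt (hO.mem_nhds (hmem t ht))).mdifferentiableAt
              one_ne_zero) (hγ.mdifferentiableAt one_ne_zero)
          rw [h1]
          exact hK _ (hmem t ht) _
      _ ≤ K * r' := by gcongr
  have hlim : Tendsto (fun r' => (K : ℝ≥0∞) * r') (nhdsWithin (edist x y) (Set.Ioi (edist x y)))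
      (nhds (K * edist x y)) :=
    (ENNReal.Tendsto.const_mul tendsto_id (Or.inr ENNReal.coe_ne_top)).mono_left nhdsWithin_le_nhds
  have : (nhdsWithin (edist x y) (Set.Ioi (edist x y))).NeBot := nhdsGT_neBot_of_exists_gt ⟨r, hxy⟩
  exact ge_of_tendsto hlim (eventually_of_mem (Ioo_mem_nhdsGT hxy) key)

end RiemannianDistance

section RiemannianDistanceMetric

open scoped NNReal ENNReal

variable {E : Type*} [NormedAddCommGroup E] [NormedSpace ℝ E] {H : Type*} [TopologicalSpace H]
  {I : ModelWithCorners ℝ E H} {M : Type*} [PseudoMetricSpace M] [ChartedSpace H M]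
  [RiemannianBundle (fun x : M => TangentSpace I x)] [IsRiemannianManifold I M]
  {E' : Type*} [NormedAddCommGroup E'] [NormedSpace ℝ E'] {H' : Type*} [TopologicalSpace H']
  {I' : ModelWithCorners ℝ E' H'} {M' : Type*} [PseudoMetricSpace M'] [ChartedSpace H' M']
  [RiemannianBundle (fun x : M' => TangentSpace I' x)] [IsRiemannianManifold I' M']

/-- A map with locally bounded derivative is locally Lipschitz for the Riemannian distances. -/
lemma eventually_dist_le_of_norm_mfderiv_le [IsManifold I 1 M] [IsManifold I' 1 M'] {G : M → M'}
    {K : ℝ} (hK0 : 0 ≤ K) {p : M} (hG : ∀ᶠ y in nhds p, ContMDiffAt I I' 1 G y)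
    (hK : ∀ᶠ y in nhds p, ∀ v : TangentSpace I y, ‖mfderiv I I' G y v‖ ≤ K * ‖v‖) :
    ∃ N ∈ nhds p, ∀ x ∈ N, ∀ y ∈ N, dist (G x) (G y) ≤ K * dist x y := by
  obtain ⟨O, hO, hOo, hpO⟩ := eventually_nhds_iff.1 (hG.and hK)
  obtain ⟨ε, hε, hball⟩ := Metric.mem_nhds_iff.1 (hOo.mem_nhds hpO)
  lift K to ℝ≥0 using hK0
  refine ⟨Metric.ball p (ε / 3), Metric.ball_mem_nhds _ (by positivity), fun x hx y hy => ?_⟩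
  rw [Metric.mem_ball] at hx hy
  have h := edist_le_mul_of_enorm_mfderiv_le (I := I) (I' := I') (G := G) (K := K) (x := x)
    (y := y) (r := ENNReal.ofReal (2 * (ε / 3))) hOo
    (fun z hz => (hO z hz).1.contMDiffWithinAt) (fun z hz v => ?_) ?_ ?_
  · rw [edist_dist, edist_dist, ← ENNReal.ofReal_coe_nnreal,
      ← ENNReal.ofReal_mul K.coe_nonneg] at h
    exact (ENNReal.ofReal_le_ofReal_iff (by positivity)).1 h
  · rw [← ofReal_norm, ← ofReal_norm, ← ENNReal.ofReal_coe_nnreal,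
      ← ENNReal.ofReal_mul K.coe_nonneg]
    exact ENNReal.ofReal_le_ofReal ((hO z hz).2 v)
  · rw [Metric.eball_ofReal]
    refine fun z hz => hball (Metric.mem_ball.2 ?_)
    linarith [Metric.mem_ball.1 hz, dist_triangle z x p]
  · rw [edist_dist]
    refine (ENNReal.ofReal_lt_ofReal_iff (by positivity)).2 ?_
    linarith [dist_triangle_right x y p]

end RiemannianDistanceMetric

section Charts

variable {d : ℕ} {M : Type*}

section

variable [TopologicalSpace M] [ChartedSpace 𝔼(d) M]

lemma extChartAt_eq_chartAt (x : M) : ⇑(extChartAt (𝓡 d) x) = chartAt 𝔼(d) x := by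
  ext y : 1
  simp

lemma extChartAt_symm_eq_chartAt_symm (x : M) :
    ⇑(extChartAt (𝓡 d) x).symm = (chartAt 𝔼(d) x).symm := by
  ext y : 1
  simp

lemma contMDiffAt_chartAt_symm {x : M} {y : 𝔼(d)} (hy : y ∈ (chartAt 𝔼(d) x).target) {n : ℕ∞ω}
    [IsManifold (𝓡 d) n M] : ContMDiffAt (𝓡 d) (𝓡 d) n (chartAt 𝔼(d) x).symm y :=
  (contMDiffOn_chart_symm (I := 𝓡 d) (n := n)).contMDiffAt
    ((chartAt 𝔼(d) x).open_target.mem_nhds hy)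

lemma contMDiffAt_chartAt {x y : M} (hy : y ∈ (chartAt 𝔼(d) x).source) {n : ℕ∞ω}
    [IsManifold (𝓡 d) n M] : ContMDiffAt (𝓡 d) (𝓡 d) n (chartAt 𝔼(d) x) y :=
  (contMDiffOn_chart (I := 𝓡 d) (n := n)).contMDiffAt ((chartAt 𝔼(d) x).open_source.mem_nhds hy)

end

variable [MetricSpace M] [ChartedSpace (𝔼(d)) M]
  [IsManifold (𝓡 d) ∞ M] [RiemannianBundle (fun x : M => TangentSpace (𝓡 d) x)]
  [IsContMDiffRiemannianBundle (𝓡 d) ∞ (𝔼(d))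
    (fun x : M => TangentSpace (𝓡 d) x)]

lemma isContinuousRiemannianBundle_tangentSpace :
    IsContinuousRiemannianBundle 𝔼(d) (fun x : M => TangentSpace (𝓡 d) x) := by
  have := ‹IsContMDiffRiemannianBundle (𝓡 d) ∞ (EuclideanSpace ℝ (Fin d))
    (fun x : M => TangentSpace (𝓡 d) x)›
  obtain ⟨g, hg, hgi⟩ := this.exists_contMDiff
  exact ⟨g, hg.continuous, hgi⟩

variable [IsRiemannianManifold (𝓡 d) M]

/-- Charts are locally Lipschitz: in the trivialization of the tangent bundle given by the chart, the
Riemannian norms are locally comparable with the norm of the model space. -/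
lemma exists_nhds_dist_chartAt_le (p : M) :
    ∃ C > 0, ∃ N ∈ nhds p, ∀ x ∈ N, ∀ y ∈ N,
      dist (chartAt 𝔼(d) p x) (chartAt 𝔼(d) p y) ≤ C * dist x y := by
  have := isContinuousRiemannianBundle_tangentSpace (d := d) (M := M)
  obtain ⟨C, hC, h⟩ :=
    eventually_norm_trivializationAt_lt 𝔼(d) (fun x : M => TangentSpace (𝓡 d) x) p
  refine ⟨C, hC, eventually_dist_le_of_norm_mfderiv_le (I := 𝓡 d) (I' := 𝓡 d) hC.le ?_ ?_⟩
  · filter_upwards [chart_source_mem_nhds 𝔼(d) p] with y hy using contMDiffAt_chartAt hy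
  · filter_upwards [h, chart_source_mem_nhds 𝔼(d) p] with y hy hys v
    rw [norm_tangentSpace_vectorSpace]
    have h1 := TangentBundle.continuousLinearMapAt_trivializationAt (I := 𝓡 d) hys
    rw [extChartAt_eq_chartAt] at h1
    have h2 := (((trivializationAt 𝔼(d) (fun x : M => TangentSpace (𝓡 d) x)
      p).continuousLinearMapAt ℝ y).le_opNorm v).trans
      (mul_le_mul_of_nonneg_right hy.le (norm_nonneg v))
    rw [h1] at h2
    exact h2

lemma exists_nhds_dist_chartAt_symm_le (p : M) :
    ∃ C > 0, ∃ N ∈ nhds (chartAt 𝔼(d) p p), ∀ x ∈ N, ∀ y ∈ N,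
      dist ((chartAt 𝔼(d) p).symm x) ((chartAt 𝔼(d) p).symm y) ≤ C * dist x y := by
  have := isContinuousRiemannianBundle_tangentSpace (d := d) (M := M)
  obtain ⟨C, hC, h⟩ :=
    eventually_norm_symmL_trivializationAt_lt 𝔼(d) (fun x : M => TangentSpace (𝓡 d) x) p
  refine ⟨C, hC, eventually_dist_le_of_norm_mfderiv_le (I := 𝓡 d) (I' := 𝓡 d) hC.le ?_ ?_⟩
  · filter_upwards [chart_target_mem_nhds 𝔼(d) p] with y hy using contMDiffAt_chartAt_symm hy
  · have hcont : ContinuousAt (chartAt 𝔼(d) p).symm (chartAt 𝔼(d) p p) :=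
      (chartAt 𝔼(d) p).continuousAt_symm (mem_chart_target 𝔼(d) p)
    have h' : ∀ᶠ y in nhds ((chartAt 𝔼(d) p).symm (chartAt 𝔼(d) p p)),
        ‖(trivializationAt 𝔼(d) (fun x : M => TangentSpace (𝓡 d) x) p).symmL ℝ y‖ < C := by
      rwa [(chartAt 𝔼(d) p).left_inv (mem_chart_source 𝔼(d) p)]
    filter_upwards [hcont.eventually h', chart_target_mem_nhds 𝔼(d) p] with y hy hyt v
    rw [norm_tangentSpace_vectorSpace (v := v)]
    have h1 := TangentBundle.symmL_trivializationAt (I := 𝓡 d) (x₀ := p)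
      ((chartAt 𝔼(d) p).map_target hyt)
    have h2 := (((trivializationAt 𝔼(d) (fun x : M => TangentSpace (𝓡 d) x)
      p).symmL ℝ ((chartAt 𝔼(d) p).symm y)).le_opNorm v).trans
      (mul_le_mul_of_nonneg_right hy.le (norm_nonneg _))
    rw [h1, ModelWithCorners.range_eq_univ, mfderivWithin_univ, extChartAt_symm_eq_chartAt_symm,
      extChartAt_eq_chartAt, (chartAt 𝔼(d) p).right_inv hyt] at h2
    exact h2

end Charts

/-! ### The norm of the derivative -/

section NormDerivative

variable {E : Type*} [NormedAddCommGroup E] [NormedSpace ℝ E] {H : Type*} [TopologicalSpace H]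
  {I : ModelWithCorners ℝ E H} {M : Type*} [TopologicalSpace M] [ChartedSpace H M]
  [IsManifold I 1 M] [RiemannianBundle (fun x : M => TangentSpace I x)]
  [IsContinuousRiemannianBundle E (fun x : M => TangentSpace I x)]
  {E' : Type*} [NormedAddCommGroup E'] [NormedSpace ℝ E'] {H' : Type*} [TopologicalSpace H']
  {I' : ModelWithCorners ℝ E' H'} {M' : Type*} [TopologicalSpace M'] [ChartedSpace H' M']
  [IsManifold I' 1 M'] [RiemannianBundle (fun x : M' => TangentSpace I' x)]
  [IsContinuousRiemannianBundle E' (fun x : M' => TangentSpace I' x)]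

/-- The operator norm of the derivative of a `C^1` map is continuous: the trivializations of the
tangent bundles change it by factors close to `1`. -/
lemma continuousAt_norm_mfderiv {G : M → M'} {q : M} (hG : ContMDiffAt I I' 1 G q) :
    ContinuousAt (fun y => ‖mfderiv I I' G y‖) q := by
  let T := trivializationAt E (fun x : M => TangentSpace I x) q
  let T' := trivializationAt E' (fun x : M' => TangentSpace I' x) (G q)
  let A : M → E →L[ℝ] E' := inTangentCoordinates I I' id G (fun y => mfderiv I I' G y) q
  have hA : ContinuousAt A q := (hG.mfderiv_const (m := 0) (by simp)).continuousAt
  -- `DG y` read in the trivializations, as a map between two fixed tangent spaces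
  let mid : M → TangentSpace I q →L[ℝ] TangentSpace I' (G q) := fun y =>
    (T'.symmL ℝ (G q)).comp ((A y).comp (T.continuousLinearMapAt ℝ q))
  have hmid : ContinuousAt (fun y => ‖mid y‖) q :=
    (continuousAt_const.clm_comp (hA.clm_comp continuousAt_const)).norm
  have hTq : q ∈ T.baseSet := FiberBundle.mem_baseSet_trivializationAt' q
  have hTq' : G q ∈ T'.baseSet := FiberBundle.mem_baseSet_trivializationAt' (G q)
  have hbase : ∀ᶠ y in nhds q, y ∈ T.baseSet ∧ G y ∈ T'.baseSet :=
    (T.open_baseSet.eventually_mem hTq).and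
      (hG.continuousAt.eventually (T'.open_baseSet.eventually_mem hTq'))
  have hmidq : ∀ y, y ∈ T.baseSet → ∀ v : TangentSpace I y,
      mid y (T.symmL ℝ q (T.continuousLinearMapAt ℝ y v)) =
        T'.symmL ℝ (G q) (T'.continuousLinearMapAt ℝ (G y) (mfderiv I I' G y v)) := fun y hy v => by
    simp only [mid, ContinuousLinearMap.comp_apply]
    rw [T.continuousLinearMapAt_symmL hTq]
    congr 1
    change T'.continuousLinearMapAt ℝ (G y) (mfderiv I I' G y (T.symmL ℝ y _)) = _
    rw [T.symmL_continuousLinearMapAt hy]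
  have hmid0 : ‖mid q‖ = ‖mfderiv I I' G q‖ := by
    congr 1
    ext v
    have := hmidq q hTq v
    rwa [T.symmL_continuousLinearMapAt hTq, T'.symmL_continuousLinearMapAt hTq'] at this
  have upper : ∀ r : ℝ, 1 < r → ∀ᶠ y in nhds q, ‖mfderiv I I' G y‖ ≤ r * ‖mid y‖ * r := by
    intro r hr
    filter_upwards [hbase,
      eventually_norm_symmL_trivializationAt_self_comp_lt E (fun x : M => TangentSpace I x) q hr,
      hG.continuousAt.eventually (eventually_norm_symmL_trivializationAt_comp_self_lt E'
        (fun x : M' => TangentSpace I' x) (G q) hr)] with y hy h1 h2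
    have heq : mfderiv I I' G y = ((T'.symmL ℝ (G y)).comp (T'.continuousLinearMapAt ℝ (G q))).comp
        ((mid y).comp ((T.symmL ℝ q).comp (T.continuousLinearMapAt ℝ y))) := by
      ext v
      simp only [ContinuousLinearMap.comp_apply]
      rw [hmidq y hy.1 v, T'.continuousLinearMapAt_symmL hTq', T'.symmL_continuousLinearMapAt hy.2]
    rw [heq, mul_assoc]
    refine (ContinuousLinearMap.opNorm_comp_le _ _).trans ?_
    refine mul_le_mul h2.le ((ContinuousLinearMap.opNorm_comp_le _ _).trans ?_) (norm_nonneg _)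
      (by linarith)
    exact mul_le_mul_of_nonneg_left h1.le (norm_nonneg _)
  have lower : ∀ r : ℝ, 1 < r → ∀ᶠ y in nhds q, ‖mid y‖ ≤ r * ‖mfderiv I I' G y‖ * r := by
    intro r hr
    filter_upwards [
      eventually_norm_symmL_trivializationAt_comp_self_lt E (fun x : M => TangentSpace I x) q hr,
      hG.continuousAt.eventually (eventually_norm_symmL_trivializationAt_self_comp_lt E'
        (fun x : M' => TangentSpace I' x) (G q) hr)] with y h1 h2
    have heq : mid y = ((T'.symmL ℝ (G q)).comp (T'.continuousLinearMapAt ℝ (G y))).comp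
        ((mfderiv I I' G y).comp ((T.symmL ℝ y).comp (T.continuousLinearMapAt ℝ q))) := rfl
    rw [heq, mul_assoc]
    refine (ContinuousLinearMap.opNorm_comp_le _ _).trans ?_
    refine mul_le_mul h2.le ((ContinuousLinearMap.opNorm_comp_le _ _).trans ?_) (norm_nonneg _)
      (by linarith)
    exact mul_le_mul_of_nonneg_left h1.le (norm_nonneg _)
  refine tendsto_order.2 ⟨fun a ha => ?_, fun a ha => ?_⟩
  · replace ha : a < ‖mid q‖ := by rw [hmid0]; exact ha
    have hc : Tendsto (fun r : ℝ => r * a * r) (nhdsWithin 1 (Set.Ioi 1)) (nhds (1 * a * 1)) :=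
      ((continuous_id.mul continuous_const).mul continuous_id).continuousWithinAt.tendsto
    rw [one_mul, mul_one] at hc
    obtain ⟨r, hr, hr1⟩ := ((hc.eventually (gt_mem_nhds ha)).and self_mem_nhdsWithin).exists
    filter_upwards [lower r hr1, hmid.eventually (lt_mem_nhds hr)] with y h1 h2
    have hr1' : (1 : ℝ) < r := hr1
    have h3 : r * a * r < r * ‖mfderiv I I' G y‖ * r := h2.trans_le h1
    by_contra! hcon
    have h4 : r * ‖mfderiv I I' G y‖ * r ≤ r * a * r := by gcongr
    linarith
  · replace ha : ‖mid q‖ < a := by rw [hmid0]; exact ha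
    have hc : Tendsto (fun r : ℝ => r * ‖mid q‖ * r) (nhdsWithin 1 (Set.Ioi 1))
        (nhds (1 * ‖mid q‖ * 1)) :=
      ((continuous_id.mul continuous_const).mul continuous_id).continuousWithinAt.tendsto
    rw [one_mul, mul_one] at hc
    obtain ⟨r, hr, hr1⟩ := ((hc.eventually (gt_mem_nhds ha)).and self_mem_nhdsWithin).exists
    have hm : ContinuousAt (fun y => r * ‖mid y‖ * r) q :=
      (continuousAt_const.mul hmid).mul continuousAt_const
    filter_upwards [upper r hr1, hm.eventually (gt_mem_nhds hr)] with y h1 h2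
    exact h1.trans_lt h2

end NormDerivative

section LocalDiffeomorph

variable {d : ℕ} {M : Type*} [MetricSpace M] [ChartedSpace 𝔼(d) M]
  [RiemannianBundle (fun x : M => TangentSpace (𝓡 d) x)]

lemma normDerivInv_nonneg (f : M → M) (x : M) : 0 ≤ normDerivInv d f x :=
  norm_nonneg (mfderiv (𝓡 d) (𝓡 d) f x).inverse

/-- The positivity fails in dimension `0`, where all norms of linear maps vanish. -/
lemma normDerivInv_pos (hd : 0 < d) {f : M → M} {x : M} {n : ℕ∞ω} (hn : n ≠ 0)
    (hf : IsLocalDiffeomorphAt (𝓡 d) (𝓡 d) n f x) : 0 < normDerivInv d f x := by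
  let e := hf.mfderivToContinuousLinearEquiv hn
  have hinv : (mfderiv (𝓡 d) (𝓡 d) f x).inverse = (e.symm : _ →L[ℝ] _) :=
    ContinuousLinearMap.inverse_equiv e
  refine (normDerivInv_nonneg f x).lt_of_ne' fun h0 => ?_
  replace h0 : (mfderiv (𝓡 d) (𝓡 d) f x).inverse = 0 :=
    (ContinuousLinearMap.opNorm_zero_iff _).1 h0
  rw [hinv] at h0
  let v : 𝔼(d) := EuclideanSpace.single ⟨0, hd⟩ 1
  have h1 : e.symm v = 0 := congrArg (fun L : 𝔼(d) →L[ℝ] 𝔼(d) => L v) h0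
  have h2 : v = 0 := e.symm.map_eq_zero_iff.1 h1
  have h3 := congrArg (fun w : 𝔼(d) => w ⟨0, hd⟩) h2
  simp [v] at h3

/-- The Riemannian norms at two equal points agree; all tangent spaces are the same model space, but
their norms depend on the base point. -/
lemma norm_tangentSpace_congr {q q' : M} (h : q = q') (v : 𝔼(d)) :
    ‖(show TangentSpace (𝓡 d) q from v)‖ = ‖(show TangentSpace (𝓡 d) q' from v)‖ := by
  subst h
  rfl

/-- If `G` is a local inverse of `f` at `q`, then `‖Df⁻¹‖` at `G q` is `‖DG‖` at `q`. -/
lemma normDerivInv_eq_norm_mfderiv {f G : M → M} {q : M} {n : ℕ∞ω} (hn : n ≠ 0)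
    (hf : IsLocalDiffeomorphAt (𝓡 d) (𝓡 d) n f (G q))
    (hG : MDifferentiableAt (𝓡 d) (𝓡 d) G q) (hfG : f ∘ G =ᶠ[nhds q] id) :
    normDerivInv d f (G q) = ‖mfderiv (𝓡 d) (𝓡 d) G q‖ := by
  have hq : f (G q) = q := hfG.self_of_nhds
  have hcomp : ∀ v : 𝔼(d), mfderiv (𝓡 d) (𝓡 d) f (G q) (mfderiv (𝓡 d) (𝓡 d) G q v) = v :=
      fun v => by
    have h1 := mfderiv_comp q (hf.mdifferentiableAt hn) hG
    have h2 : mfderiv (𝓡 d) (𝓡 d) (f ∘ G) q = mfderiv (𝓡 d) (𝓡 d) id q := hfG.mfderiv_eq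
    rw [mfderiv_id] at h2
    exact congrArg (fun L : 𝔼(d) →L[ℝ] 𝔼(d) => L v) (h1.symm.trans h2)
  let e := hf.mfderivToContinuousLinearEquiv hn
  have hinv : (mfderiv (𝓡 d) (𝓡 d) f (G q)).inverse = (e.symm : _ →L[ℝ] _) :=
    ContinuousLinearMap.inverse_equiv e
  have heq : ∀ v : 𝔼(d), (mfderiv (𝓡 d) (𝓡 d) f (G q)).inverse v = mfderiv (𝓡 d) (𝓡 d) G q v :=
    fun v => by
      rw [hinv]
      exact (e.symm_apply_eq).2 (hcomp v).symm
  refine le_antisymm ?_ ?_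
  · refine ContinuousLinearMap.opNorm_le_bound _
      (norm_nonneg (mfderiv (𝓡 d) (𝓡 d) G q)) fun v => ?_
    have h3 := (mfderiv (𝓡 d) (𝓡 d) G q).le_opNorm v
    rw [heq v]
    refine h3.trans (le_of_eq ?_)
    congr 1
    exact norm_tangentSpace_congr hq.symm v
  · refine ContinuousLinearMap.opNorm_le_bound _ (normDerivInv_nonneg f (G q)) fun v => ?_
    have h3 := ((mfderiv (𝓡 d) (𝓡 d) f (G q)).inverse).le_opNorm v
    rw [heq v] at h3
    refine h3.trans (le_of_eq ?_)
    congr 1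
    exact norm_tangentSpace_congr hq v

lemma exists_localInverse {f : M → M} {x : M} {n : ℕ∞ω} (hn : 1 ≤ n)
    (hf : IsLocalDiffeomorphAt (𝓡 d) (𝓡 d) n f x) :
    ∃ G : M → M, G (f x) = x ∧ ContinuousAt G (f x) ∧
      (∀ᶠ q in nhds (f x), ContMDiffAt (𝓡 d) (𝓡 d) 1 G q ∧ normDerivInv d f (G q) =
        ‖mfderiv (𝓡 d) (𝓡 d) G q‖) ∧ ∀ᶠ y in nhds x, G (f y) = y := by
  have hn0 : n ≠ 0 := fun h => by simp [h] at hn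
  obtain ⟨Φ, hx, hΦ⟩ := hf
  have hfx : f x ∈ Φ.target := by rw [hΦ hx]; exact Φ.map_source hx
  have hG : ∀ q ∈ Φ.target, ContMDiffAt (𝓡 d) (𝓡 d) 1 Φ.symm q := fun q hq =>
    (Φ.contMDiffOn_invFun.contMDiffAt (Φ.open_target.mem_nhds hq)).of_le hn
  refine ⟨Φ.symm, ?_, (hG _ hfx).continuousAt, ?_, ?_⟩
  · rw [hΦ hx]
    exact Φ.left_inv hx
  · filter_upwards [Φ.open_target.mem_nhds hfx] with q hq
    refine ⟨hG q hq, normDerivInv_eq_norm_mfderiv hn0 ⟨Φ, Φ.map_target hq, hΦ⟩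
      ((hG q hq).mdifferentiableAt one_ne_zero) ?_⟩
    filter_upwards [Φ.open_target.mem_nhds hq] with q' hq'
    exact (hΦ (Φ.map_target hq')).trans (Φ.right_inv hq')
  · filter_upwards [Φ.open_source.mem_nhds hx] with y hy
    rw [hΦ hy]
    exact Φ.left_inv hy

variable [IsManifold (𝓡 d) ∞ M]

/-- A local diffeomorphism expands distances locally at least by the inverse of any local bound
on the norm of the inverse of its derivative. -/
lemma exists_nhds_dist_le_mul_dist [IsRiemannianManifold (𝓡 d) M] {f : M → M} {x : M} {n : ℕ∞ω}
    (hn : 1 ≤ n) (hf : IsLocalDiffeomorphAt (𝓡 d) (𝓡 d) n f x) {K : ℝ}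
    (hK : ∀ᶠ y in nhds x, normDerivInv d f y ≤ K) :
    ∃ N ∈ nhds x, ∀ y ∈ N, ∀ z ∈ N, dist y z ≤ K * dist (f y) (f z) := by
  obtain ⟨G, hGx, hGc, hG, hGf⟩ := exists_localInverse hn hf
  have hK0 : 0 ≤ K := (normDerivInv_nonneg f x).trans hK.self_of_nhds
  have hK' : ∀ᶠ q in nhds (f x), normDerivInv d f (G q) ≤ K :=
    hGc.eventually (p := fun y => normDerivInv d f y ≤ K) (by rw [hGx]; exact hK)
  obtain ⟨N, hN, h⟩ := eventually_dist_le_of_norm_mfderiv_le (I := 𝓡 d) (I' := 𝓡 d) (G := G) hK0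
    (hG.mono fun q hq => hq.1) (by
      filter_upwards [hG, hK'] with q hq hqK v
      rw [hq.2] at hqK
      exact (ContinuousLinearMap.le_opNorm _ v).trans
        (mul_le_mul_of_nonneg_right hqK (norm_nonneg _)))
  refine ⟨f ⁻¹' N ∩ {y | G (f y) = y}, inter_mem (hf.contMDiffAt.continuousAt hN) hGf,
    fun y hy z hz => ?_⟩
  have := h (f y) hy.1 (f z) hz.1
  rwa [show G (f y) = y from hy.2, show G (f z) = z from hz.2] at this

variable [IsContMDiffRiemannianBundle (𝓡 d) ∞ 𝔼(d) (fun x : M => TangentSpace (𝓡 d) x)]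

lemma continuousAt_normDerivInv {f : M → M} {x : M} {n : ℕ∞ω} (hn : 1 ≤ n)
    (hf : IsLocalDiffeomorphAt (𝓡 d) (𝓡 d) n f x) : ContinuousAt (normDerivInv d f) x := by
  have := isContinuousRiemannianBundle_tangentSpace (d := d) (M := M)
  obtain ⟨G, -, -, hG, hGf⟩ := exists_localInverse hn hf
  have hfc := hf.contMDiffAt.continuousAt
  have h1 : ContinuousAt (fun y => ‖mfderiv (𝓡 d) (𝓡 d) G (f y)‖) x :=
    ContinuousAt.comp (f := f) (continuousAt_norm_mfderiv (I := 𝓡 d) (I' := 𝓡 d)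
      hG.self_of_nhds.1) hfc
  refine h1.congr ?_
  filter_upwards [hfc.eventually hG, hGf] with y hy hy'
  rw [← hy.2, hy']

end LocalDiffeomorph

/-! ### The volume density in charts -/

section Density

variable {d : ℕ} {M : Type*} [TopologicalSpace M] [ChartedSpace 𝔼(d) M]

instance (x : M) : FiniteDimensional ℝ (TangentSpace (𝓡 d) x) :=
  inferInstanceAs (FiniteDimensional ℝ 𝔼(d))

lemma finrank_tangentSpace (x : M) : Module.finrank ℝ (TangentSpace (𝓡 d) x) = d :=
  (finrank_euclideanSpace (𝕜 := ℝ) (ι := Fin d)).trans (Fintype.card_fin d)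

/-- The coordinate vector fields of a chart are `C¹`. -/
lemma contMDiffAt_mfderiv_chartAt_symm_apply [IsManifold (𝓡 d) ∞ M] {x : M} {y : 𝔼(d)}
    (hy : y ∈ (chartAt 𝔼(d) x).target) (v : 𝔼(d)) :
    ContMDiffAt (𝓡 d) (𝓡 d).tangent 1 (fun z : 𝔼(d) =>
      (TotalSpace.mk' 𝔼(d) ((chartAt 𝔼(d) x).symm z)
        (mfderiv (𝓡 d) (𝓡 d) (chartAt 𝔼(d) x).symm z v) : TangentBundle (𝓡 d) M)) y := by
  have h2 : ContMDiffAt (𝓡 d) (𝓡 d) 2 (chartAt 𝔼(d) x).symm y := contMDiffAt_chartAt_symm hy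
  refine ContMDiffAt.clm_apply_of_inCoordinates (IM := 𝓡 d) (IB₁ := 𝓡 d) (IB₂ := 𝓡 d)
    (E₁ := fun z : 𝔼(d) => TangentSpace (𝓡 d) z) (E₂ := fun z : M => TangentSpace (𝓡 d) z)
    (b₁ := id) (b₂ := (chartAt 𝔼(d) x).symm) (v := fun _ => v)
    (ϕ := fun z => mfderiv (𝓡 d) (𝓡 d) (chartAt 𝔼(d) x).symm z)
    (h2.mfderiv_const (m := 1) (by norm_num)) ?_ (h2.of_le (by norm_num))
  rw [contMDiffAt_totalSpace]
  refine ⟨contMDiffAt_id (I := 𝓡 d) (M := 𝔼(d)), ?_⟩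
  refine (contMDiffAt_const (I := 𝓡 d) (M := 𝔼(d)) (I' := 𝓡 d) (M' := 𝔼(d))
    (c := v)).congr_of_eventuallyEq (Eventually.of_forall fun z => ?_)
  simp

variable [RiemannianBundle (fun x : M => TangentSpace (𝓡 d) x)]

/-- The absolute determinant only depends on the base points of the tangent spaces and on the
underlying linear map of the model space. -/
lemma absDet_tangentSpace_congr {V : Type*} [NormedAddCommGroup V] [InnerProductSpace ℝ V]
    [FiniteDimensional ℝ V] {q q' : M} (h : q = q') (L : V →ₗ[ℝ] 𝔼(d)) :
    absDet (V := V) (W := TangentSpace (𝓡 d) q) L =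
      absDet (V := V) (W := TangentSpace (𝓡 d) q') L := by
  subst h
  rfl

variable [IsManifold (𝓡 d) ∞ M]

lemma chartDensity_pos {x : M} {y : 𝔼(d)} (hy : y ∈ (chartAt 𝔼(d) x).target) :
    0 < chartDensity x y := by
  have h1 := (contMDiffAt_chartAt_symm (n := 1) hy).mdifferentiableAt one_ne_zero
  have h2 := (contMDiffAt_chartAt (n := 1) ((chartAt 𝔼(d) x).map_target hy)).mdifferentiableAt
    one_ne_zero
  let L : 𝔼(d) →L[ℝ] TangentSpace (𝓡 d) ((chartAt 𝔼(d) x).symm y) :=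
    mfderiv (𝓡 d) (𝓡 d) (chartAt 𝔼(d) x).symm y
  let A : TangentSpace (𝓡 d) ((chartAt 𝔼(d) x).symm y) →L[ℝ] 𝔼(d) :=
    mfderiv (𝓡 d) (𝓡 d) (chartAt 𝔼(d) x) ((chartAt 𝔼(d) x).symm y)
  have hAL : ∀ v, A (L v) = v := fun v => by
    have h3 := mfderiv_comp y h2 h1
    have h4 : (chartAt 𝔼(d) x ∘ (chartAt 𝔼(d) x).symm) =ᶠ[nhds y] id :=
      (chartAt 𝔼(d) x).eventually_right_inverse hy
    have h5 : mfderiv (𝓡 d) (𝓡 d) (chartAt 𝔼(d) x ∘ (chartAt 𝔼(d) x).symm) y =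
      mfderiv (𝓡 d) (𝓡 d) id y := h4.mfderiv_eq
    rw [mfderiv_id] at h5
    exact congrArg (fun L : 𝔼(d) →L[ℝ] 𝔼(d) => L v) (h3.symm.trans h5)
  exact absDet_pos_of_leftInverse (V := 𝔼(d))
    (W := TangentSpace (𝓡 d) ((chartAt 𝔼(d) x).symm y))
    (finrank_euclideanSpace_fin.trans (finrank_tangentSpace _).symm)
    L.toLinearMap A.toLinearMap (LinearMap.ext hAL)

variable [IsContMDiffRiemannianBundle (𝓡 d) ∞ 𝔼(d) (fun x : M => TangentSpace (𝓡 d) x)]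

lemma contDiffAt_inner_mfderiv_chartAt_symm {x : M} {y : 𝔼(d)}
    (hy : y ∈ (chartAt 𝔼(d) x).target) (v w : 𝔼(d)) :
    ContDiffAt ℝ 1 (fun z : 𝔼(d) => (inner ℝ (mfderiv (𝓡 d) (𝓡 d) (chartAt 𝔼(d) x).symm z v)
      (mfderiv (𝓡 d) (𝓡 d) (chartAt 𝔼(d) x).symm z w) : ℝ)) y := by
  have : IsContMDiffRiemannianBundle (𝓡 d) 1 𝔼(d) (fun x : M => TangentSpace (𝓡 d) x) :=
    IsContMDiffRiemannianBundle.of_le (n := ∞) (by exact_mod_cast le_top)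
  rw [← contMDiffAt_iff_contDiffAt]
  exact ContMDiffAt.inner_bundle (IB := 𝓡 d) (F := 𝔼(d)) (E := fun x : M => TangentSpace (𝓡 d) x)
    (contMDiffAt_mfderiv_chartAt_symm_apply hy v) (contMDiffAt_mfderiv_chartAt_symm_apply hy w)

lemma contDiffAt_chartDensity {x : M} {y : 𝔼(d)} (hy : y ∈ (chartAt 𝔼(d) x).target) :
    ContDiffAt ℝ 1 (chartDensity (M := M) x) y := by
  have hpos := chartDensity_pos hy
  have h : ContDiffAt ℝ 1 (fun z => Matrix.det (Matrix.of fun i j =>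
      (inner ℝ (mfderiv (𝓡 d) (𝓡 d) (chartAt 𝔼(d) x).symm z (stdOrthonormalBasis ℝ 𝔼(d) i))
      (mfderiv (𝓡 d) (𝓡 d) (chartAt 𝔼(d) x).symm z (stdOrthonormalBasis ℝ 𝔼(d) j)) : ℝ))) y := by
    simp only [Matrix.det_apply]
    refine ContDiffAt.sum fun σ _ => ContDiffAt.const_smul _ (contDiffAt_prod fun i _ => ?_)
    exact contDiffAt_inner_mfderiv_chartAt_symm hy _ _
  exact h.sqrt (Real.sqrt_pos.1 hpos).ne'

end Density

section Jacobian

variable {d : ℕ} {M : Type*} [MetricSpace M] [ChartedSpace 𝔼(d) M] [IsManifold (𝓡 d) ∞ M]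
  [RiemannianBundle (fun x : M => TangentSpace (𝓡 d) x)]

/-- The Jacobian of `h` is the Jacobian of its coordinate expression, corrected by the volume
densities of the two charts. -/
lemma chartDensity_mul_abs_det_fderiv {h : M → M} {x x' : M} {y : 𝔼(d)}
    (hy : y ∈ (chartAt 𝔼(d) x).target)
    (hh : MDifferentiableAt (𝓡 d) (𝓡 d) h ((chartAt 𝔼(d) x).symm y))
    (hy' : h ((chartAt 𝔼(d) x).symm y) ∈ (chartAt 𝔼(d) x').source) :
    chartDensity x' (chartAt 𝔼(d) x' (h ((chartAt 𝔼(d) x).symm y))) *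
      |(fderiv ℝ (fun z => chartAt 𝔼(d) x' (h ((chartAt 𝔼(d) x).symm z))) y).det| =
    absDetDeriv d h ((chartAt 𝔼(d) x).symm y) * chartDensity x y := by
  set τ : 𝔼(d) → 𝔼(d) := fun z => chartAt 𝔼(d) x' (h ((chartAt 𝔼(d) x).symm z)) with hτ
  have h1 := (contMDiffAt_chartAt_symm (n := 1) hy).mdifferentiableAt one_ne_zero
  have h2 := (contMDiffAt_chartAt (n := 1) hy').mdifferentiableAt one_ne_zero
  have hhs : MDifferentiableAt (𝓡 d) (𝓡 d) (h ∘ (chartAt 𝔼(d) x).symm) y := hh.comp y h1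
  have hτd : MDifferentiableAt (𝓡 d) (𝓡 d) τ y := MDifferentiableAt.comp y h2 hhs
  have hτy : τ y ∈ (chartAt 𝔼(d) x').target := (chartAt 𝔼(d) x').map_source hy'
  have h3 := (contMDiffAt_chartAt_symm (n := 1) hτy).mdifferentiableAt one_ne_zero
  have heq : (chartAt 𝔼(d) x').symm ∘ τ =ᶠ[nhds y] h ∘ (chartAt 𝔼(d) x).symm := by
    filter_upwards [hhs.continuousAt ((chartAt 𝔼(d) x').open_source.mem_nhds hy')] with z hz
    exact (chartAt 𝔼(d) x').left_inv hz
  have hD := heq.mfderiv_eq (I := 𝓡 d) (I' := 𝓡 d)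
  rw [mfderiv_comp y h3 hτd, mfderiv_comp y hh h1] at hD
  let A : 𝔼(d) →L[ℝ] 𝔼(d) := fderiv ℝ τ y
  let L' : 𝔼(d) →L[ℝ] 𝔼(d) := mfderiv (𝓡 d) (𝓡 d) (chartAt 𝔼(d) x').symm (τ y)
  let L : 𝔼(d) →L[ℝ] TangentSpace (𝓡 d) ((chartAt 𝔼(d) x).symm y) :=
    mfderiv (𝓡 d) (𝓡 d) (chartAt 𝔼(d) x).symm y
  let D : TangentSpace (𝓡 d) ((chartAt 𝔼(d) x).symm y) →L[ℝ]
      TangentSpace (𝓡 d) (h ((chartAt 𝔼(d) x).symm y)) :=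
    mfderiv (𝓡 d) (𝓡 d) h ((chartAt 𝔼(d) x).symm y)
  have hcomp : ∀ v : 𝔼(d), L' (A v) = D (L v) := fun v => by
    have := congrArg (fun L : 𝔼(d) →L[ℝ] 𝔼(d) => L v) hD
    rw [mfderiv_eq_fderiv] at this
    exact this
  have hq : (chartAt 𝔼(d) x').symm (τ y) = h ((chartAt 𝔼(d) x).symm y) :=
    (chartAt 𝔼(d) x').left_inv hy'
  have hL' : chartDensity x' (τ y) = absDet (V := 𝔼(d))
      (W := TangentSpace (𝓡 d) (h ((chartAt 𝔼(d) x).symm y))) L'.toLinearMap :=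
    absDet_tangentSpace_congr hq L'.toLinearMap
  have hE : Module.finrank ℝ 𝔼(d) = d := finrank_euclideanSpace_fin
  have e1 := absDet_comp (V := 𝔼(d)) (W := 𝔼(d))
    (X := TangentSpace (𝓡 d) (h ((chartAt 𝔼(d) x).symm y))) rfl
    (hE.trans (finrank_tangentSpace _).symm) L'.toLinearMap A.toLinearMap
  have e2 := absDet_comp (V := 𝔼(d)) (W := TangentSpace (𝓡 d) ((chartAt 𝔼(d) x).symm y))
    (X := TangentSpace (𝓡 d) (h ((chartAt 𝔼(d) x).symm y)))
    (hE.trans (finrank_tangentSpace _).symm)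
    ((finrank_tangentSpace _).trans (finrank_tangentSpace _).symm) D.toLinearMap L.toLinearMap
  have e3 : (L'.toLinearMap ∘ₗ A.toLinearMap : 𝔼(d) →ₗ[ℝ]
      TangentSpace (𝓡 d) (h ((chartAt 𝔼(d) x).symm y))) = D.toLinearMap ∘ₗ L.toLinearMap :=
    LinearMap.ext hcomp
  have e4 : absDet A.toLinearMap = |A.det| := absDet_end _
  rw [e3, e2, e4] at e1
  exact (congrArg (· * |A.det|) hL').trans e1.symm

end Jacobian

/-! ### The Riemannian volume -/

section Volume

/-- The preimage of a measurable set under a map that is continuous on a measurable set `O`, but may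
be arbitrary outside of `O`. -/
lemma measurableSet_inter_preimage {X Y : Type*} [TopologicalSpace X] [MeasurableSpace X]
    [OpensMeasurableSpace X] [TopologicalSpace Y] [MeasurableSpace Y] [BorelSpace Y]
    {g : X → Y} {O : Set X} (hO : MeasurableSet O) (hg : ContinuousOn g O) {W : Set Y}
    (hW : MeasurableSet W) : MeasurableSet (O ∩ g ⁻¹' W) := by
  have h := (continuousOn_iff_continuous_domRestrict.1 hg).measurable hW
  have h2 := (MeasurableEmbedding.subtype_coe hO).measurableSet_image' h
  convert! h2 using 1
  ext y
  simp [and_comm]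

variable {d : ℕ} {M : Type*} [MetricSpace M] [ChartedSpace 𝔼(d) M]
  [RiemannianBundle (fun x : M => TangentSpace (𝓡 d) x)]

lemma absDetDeriv_id (p : M) : absDetDeriv d (id : M → M) p = 1 := by
  have : mfderiv (𝓡 d) (𝓡 d) (id : M → M) p = ContinuousLinearMap.id ℝ _ := mfderiv_id
  rw [absDetDeriv, this]
  exact (absDet_end (LinearMap.id : TangentSpace (𝓡 d) p →ₗ[ℝ] TangentSpace (𝓡 d) p)).trans
    (by simp)

variable [IsManifold (𝓡 d) ∞ M]
  [IsContMDiffRiemannianBundle (𝓡 d) ∞ 𝔼(d) (fun x : M => TangentSpace (𝓡 d) x)]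

lemma continuousOn_chartDensity (x : M) :
    ContinuousOn (chartDensity (M := M) x) (chartAt 𝔼(d) x).target :=
  fun _ hy => (contDiffAt_chartDensity hy).continuousAt.continuousWithinAt

variable [MeasurableSpace M] [BorelSpace M]

lemma lintegral_chartVolume (x : M) {u : M → ENNReal} (hu : Measurable u) {W : Set M}
    (hW : MeasurableSet W) :
    ∫⁻ p in W, u p ∂(chartVolume (d := d) x) =
      ∫⁻ y in (chartAt 𝔼(d) x).target ∩ (chartAt 𝔼(d) x).symm ⁻¹' W,
        ENNReal.ofReal (chartDensity x y) * u ((chartAt 𝔼(d) x).symm y) := by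
  have hO := (chartAt 𝔼(d) x).open_target.measurableSet
  have hs : AEMeasurable (chartAt 𝔼(d) x).symm
      ((volume : Measure 𝔼(d)).restrict (chartAt 𝔼(d) x).target) :=
    (chartAt 𝔼(d) x).continuousOn_symm.aemeasurable hO
  have hρ : AEMeasurable (fun y => ENNReal.ofReal (chartDensity x y))
      ((volume : Measure 𝔼(d)).restrict (chartAt 𝔼(d) x).target) :=
    ((continuousOn_chartDensity x).aemeasurable hO).ennreal_ofReal
  have hv : Measurable (W.indicator u) := hu.indicator hW
  rw [← lintegral_indicator hW, chartVolume, lintegral_map' hv.aemeasurable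
    (hs.mono_ac (withDensity_absolutelyContinuous _ _))]
  have hB := measurableSet_inter_preimage hO (chartAt 𝔼(d) x).continuousOn_symm hW
  refine (lintegral_withDensity_eq_lintegral_mul₀ hρ (hv.comp_aemeasurable hs)).trans ?_
  rw [← lintegral_indicator hO, ← lintegral_indicator hB]
  refine lintegral_congr fun y => ?_
  by_cases hy : y ∈ (chartAt 𝔼(d) x).target <;>
    by_cases hyW : (chartAt 𝔼(d) x).symm y ∈ W <;> simp [hy, hyW]

lemma chartVolume_apply (x : M) {W : Set M} (hW : MeasurableSet W) :
    chartVolume (d := d) x W = ∫⁻ y in (chartAt 𝔼(d) x).target ∩ (chartAt 𝔼(d) x).symm ⁻¹' W,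
        ENNReal.ofReal (chartDensity x y) := by
  rw [← setLIntegral_one, lintegral_chartVolume x measurable_const hW]
  simp

/-- The change of variables formula in a pair of charts. -/
lemma chartVolume_image {h : M → M} {x x' : M} {W : Set M} (hW : MeasurableSet W)
    (hWx : W ⊆ (chartAt 𝔼(d) x).source) (hh : ∀ p ∈ W, MDifferentiableAt (𝓡 d) (𝓡 d) h p)
    (hWx' : Set.MapsTo h W (chartAt 𝔼(d) x').source) (hinj : Set.InjOn h W)
    (hhW : MeasurableSet (h '' W)) {u : M → ENNReal} (hu : Measurable u)
    (huW : ∀ p ∈ W, u p = ENNReal.ofReal (absDetDeriv d h p)) :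
    chartVolume (d := d) x' (h '' W) = ∫⁻ p in W, u p ∂(chartVolume (d := d) x) := by
  set φ := chartAt 𝔼(d) x with hφ
  set φ' := chartAt 𝔼(d) x' with hφ'
  let τ : 𝔼(d) → 𝔼(d) := fun z => φ' (h (φ.symm z))
  set B := φ.target ∩ φ.symm ⁻¹' W with hB
  have hBm : MeasurableSet B :=
    measurableSet_inter_preimage φ.open_target.measurableSet φ.continuousOn_symm hW
  have himg : φ'.target ∩ φ'.symm ⁻¹' (h '' W) = τ '' B := by
    ext z
    constructor
    · rintro ⟨hz, p, hp, hpz⟩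
      refine ⟨φ p, ⟨φ.map_source (hWx hp), ?_⟩, ?_⟩
      · rwa [Set.mem_preimage, φ.left_inv (hWx hp)]
      · simp only [τ]
        rw [φ.left_inv (hWx hp), hpz, φ'.right_inv hz]
    · rintro ⟨y, ⟨hy, hyW⟩, rfl⟩
      refine ⟨φ'.map_source (hWx' hyW), φ.symm y, hyW, ?_⟩
      exact (φ'.left_inv (hWx' hyW)).symm
  have hder : ∀ y ∈ B, HasFDerivWithinAt τ (fderiv ℝ τ y) B y := fun y hy => by
    have h1 := (contMDiffAt_chartAt_symm (n := 1) hy.1).mdifferentiableAt one_ne_zero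
    have h2 := (contMDiffAt_chartAt (n := 1) (hWx' hy.2)).mdifferentiableAt one_ne_zero
    have h3 : MDifferentiableAt (𝓡 d) (𝓡 d) τ y :=
      MDifferentiableAt.comp y h2 (MDifferentiableAt.comp y (hh _ hy.2) h1)
    exact h3.differentiableAt.hasFDerivAt.hasFDerivWithinAt
  have hτinj : Set.InjOn τ B := fun y hy z hz hyz => by
    have h1 := φ'.injOn (hWx' hy.2) (hWx' hz.2) hyz
    exact φ.symm.injOn hy.1 hz.1 (hinj hy.2 hz.2 h1)
  rw [chartVolume_apply x' hhW, lintegral_chartVolume x hu hW, ← hφ, ← hφ', himg, ← hB,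
    lintegral_image_eq_lintegral_abs_det_fderiv_mul volume hBm hder hτinj]
  refine setLIntegral_congr_fun hBm fun y hy => ?_
  have hJ := chartDensity_mul_abs_det_fderiv hy.1 (hh _ hy.2) (hWx' hy.2)
  rw [huW _ hy.2, ← ENNReal.ofReal_mul (abs_nonneg _),
    ← ENNReal.ofReal_mul (chartDensity_pos hy.1).le, mul_comm (chartDensity x y)]
  congr 1
  rw [mul_comm]
  exact hJ

lemma chartVolume_eq_of_subset {x x' : M} {W : Set M} (hW : MeasurableSet W)
    (hWx : W ⊆ (chartAt 𝔼(d) x).source) (hWx' : W ⊆ (chartAt 𝔼(d) x').source) :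
    chartVolume (d := d) x' W = chartVolume (d := d) x W := by
  have h := chartVolume_image (h := id) (u := fun _ => 1) hW hWx
    (fun p _ => mdifferentiableAt_id) hWx' (Set.injOn_id W) (by simpa using hW) measurable_const
    (fun p _ => by simp [absDetDeriv_id])
  simpa using h

lemma chartVolume_inter_source (x : M) {W : Set M} (hW : MeasurableSet W) :
    chartVolume (d := d) x (W ∩ (chartAt 𝔼(d) x).source) = chartVolume (d := d) x W := by
  rw [chartVolume_apply x hW, chartVolume_apply x
    (hW.inter (chartAt 𝔼(d) x).open_source.measurableSet)]
  congr 2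
  ext y
  constructor
  · rintro ⟨hy, hyW, -⟩
    exact ⟨hy, hyW⟩
  · rintro ⟨hy, hyW⟩
    exact ⟨hy, hyW, (chartAt 𝔼(d) x).map_target hy⟩

/-- On the domain of a chart, the Riemannian volume is the volume computed in this chart. -/
lemma riemannianVolume_eq_chartVolume (x : M) {W : Set M} (hW : MeasurableSet W)
    (hWx : W ⊆ (chartAt 𝔼(d) x).source) :
    riemannianVolume d M W = chartVolume (d := d) x W := by
  refine le_antisymm ?_ (le_iSup (fun x : M => chartVolume (d := d) x) x W)
  set O := (chartAt 𝔼(d) x).source with hO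
  have hOm : MeasurableSet O := (chartAt 𝔼(d) x).open_source.measurableSet
  -- a measure that dominates all chart volumes and agrees with the chart volume on `O`
  let ν : Measure M := (chartVolume (d := d) x).restrict O + (riemannianVolume d M).restrict Oᶜ
  have hν : riemannianVolume d M ≤ ν := by
    refine iSup_le fun x' => Measure.le_iff.2 fun A hA => ?_
    have h1 : chartVolume (d := d) x' (A ∩ O) ≤ chartVolume (d := d) x (A ∩ O) := by
      rw [← chartVolume_inter_source x' (hA.inter hOm)]
      have hm := (hA.inter hOm).inter (chartAt 𝔼(d) x').open_source.measurableSet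
      rw [chartVolume_eq_of_subset hm (fun p hp => hp.1.2) (fun p hp => hp.2)]
      exact measure_mono Set.inter_subset_left
    rw [Measure.add_apply, Measure.restrict_apply hA, Measure.restrict_apply hA,
      ← measure_inter_add_sdiff A hOm]
    exact add_le_add h1 (le_iSup (fun x : M => chartVolume (d := d) x) x' (A \ O))
  refine (hν W).trans (le_of_eq ?_)
  rw [Measure.add_apply, Measure.restrict_apply hW, Measure.restrict_apply hW,
    Set.inter_eq_left.2 hWx]
  have : W ∩ Oᶜ = ∅ := by
    rw [← Set.sdiff_eq, Set.sdiff_eq_empty]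
    exact hWx
  rw [this, measure_empty, add_zero]

end Volume

/-! ### The Jacobian of a local diffeomorphism -/

section JacobianDeterminant

lemma contDiff_clm_det {E : Type*} [NormedAddCommGroup E] [NormedSpace ℝ E]
    [FiniteDimensional ℝ E] {n : ℕ∞ω} : ContDiff ℝ n (fun A : E →L[ℝ] E => A.det) := by
  let b := Module.finBasis ℝ E
  have h : (fun A : E →L[ℝ] E => A.det) = fun A => Matrix.det (Matrix.of fun i j =>
      (LinearMap.toContinuousLinearMap (b.coord i)) (A (b j))) := by
    ext A
    rw [ContinuousLinearMap.det, ← LinearMap.det_toMatrix b]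
    congr 1
    ext i j
    simp [LinearMap.toMatrix_apply]
  rw [h]
  simp only [Matrix.det_apply, Matrix.of_apply]
  refine ContDiff.sum fun σ _ => ContDiff.const_smul _ (contDiff_prod fun i _ => ?_)
  exact (ContinuousLinearMap.contDiff _).comp (contDiff_id.clm_apply contDiff_const)

variable {d : ℕ} {M : Type*} [MetricSpace M] [ChartedSpace 𝔼(d) M] {f : M → M}

lemma eventually_isLocalDiffeomorphAt {x : M} {n : ℕ∞ω}
    (hf : IsLocalDiffeomorphAt (𝓡 d) (𝓡 d) n f x) :
    ∀ᶠ y in nhds x, IsLocalDiffeomorphAt (𝓡 d) (𝓡 d) n f y := by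
  obtain ⟨Φ, hx, hΦ⟩ := hf
  filter_upwards [Φ.open_source.mem_nhds hx] with y hy
  exact ⟨Φ, hy, hΦ⟩

variable [RiemannianBundle (fun x : M => TangentSpace (𝓡 d) x)]

lemma absDetDeriv_pos {x : M} {n : ℕ∞ω} (hn : n ≠ 0)
    (hf : IsLocalDiffeomorphAt (𝓡 d) (𝓡 d) n f x) : 0 < absDetDeriv d f x := by
  let e := hf.mfderivToContinuousLinearEquiv hn
  exact absDet_pos_of_leftInverse (V := TangentSpace (𝓡 d) x) (W := TangentSpace (𝓡 d) (f x))
    ((finrank_tangentSpace x).trans (finrank_tangentSpace (f x)).symm)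
    (e : TangentSpace (𝓡 d) x →L[ℝ] TangentSpace (𝓡 d) (f x)).toLinearMap
    (e.symm : TangentSpace (𝓡 d) (f x) →L[ℝ] TangentSpace (𝓡 d) x).toLinearMap
    (LinearMap.ext fun v => e.symm_apply_apply v)

variable [IsManifold (𝓡 d) ∞ M]
  [IsContMDiffRiemannianBundle (𝓡 d) ∞ 𝔼(d) (fun x : M => TangentSpace (𝓡 d) x)]

/-- Near a point where `f` is a `C²` local diffeomorphism, the Jacobian is `C¹` in charts. -/
lemma contDiffAt_absDetDeriv {x : M} (hf : IsLocalDiffeomorphAt (𝓡 d) (𝓡 d) 2 f x) :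
    ContDiffAt ℝ 1 (fun z => absDetDeriv d f ((chartAt 𝔼(d) x).symm z)) (chartAt 𝔼(d) x x) := by
  set φ := chartAt 𝔼(d) x with hφ
  set φ' := chartAt 𝔼(d) (f x) with hφ'
  have hx : x ∈ φ.source := mem_chart_source _ x
  have hfx : f x ∈ φ'.source := mem_chart_source _ (f x)
  have hy : φ x ∈ φ.target := φ.map_source hx
  have hxy : φ.symm (φ x) = x := φ.left_inv hx
  set τ : 𝔼(d) → 𝔼(d) := fun z => φ' (f (φ.symm z)) with hτ
  have hτ2 : ContDiffAt ℝ 2 τ (φ x) := by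
    have h1 : ContMDiffAt (𝓡 d) (𝓡 d) 2 φ.symm (φ x) := contMDiffAt_chartAt_symm hy
    have h2 : ContMDiffAt (𝓡 d) (𝓡 d) 2 f (φ.symm (φ x)) := by
      rw [hxy]; exact hf.contMDiffAt
    have h3 : ContMDiffAt (𝓡 d) (𝓡 d) 2 φ' (f (φ.symm (φ x))) := by
      rw [hxy]; exact contMDiffAt_chartAt hfx
    have h4 : ContMDiffAt (𝓡 d) (𝓡 d) 2 (fun z => f (φ.symm z)) (φ x) :=
      ContMDiffAt.comp (φ x) h2 h1
    exact contMDiffAt_iff_contDiffAt.1 (ContMDiffAt.comp (φ x) h3 h4)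
  have hdet : ContDiffAt ℝ 1 (fun z => (fderiv ℝ τ z).det) (φ x) :=
    contDiff_clm_det.contDiffAt.comp (φ x) (hτ2.fderiv_right (by norm_num))
  have hρ : ContDiffAt ℝ 1 (chartDensity x) (φ x) := contDiffAt_chartDensity hy
  have hρ' : ContDiffAt ℝ 1 (fun z => chartDensity (f x) (τ z)) (φ x) := by
    have : ContDiffAt ℝ 1 (chartDensity (f x)) (τ (φ x)) :=
      contDiffAt_chartDensity (φ'.map_source (by rwa [hxy]))
    exact this.comp (φ x) (hτ2.of_le (by norm_num))
  have hev : ∀ᶠ z in nhds (φ x), z ∈ φ.target ∧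
      IsLocalDiffeomorphAt (𝓡 d) (𝓡 d) 2 f (φ.symm z) ∧ f (φ.symm z) ∈ φ'.source := by
    have hc : Tendsto φ.symm (nhds (φ x)) (nhds x) := by
      simpa [hxy] using (φ.continuousAt_symm hy).tendsto
    exact (show ∀ᶠ z in nhds (φ x), z ∈ φ.target from φ.open_target.mem_nhds hy).and
      ((hc.eventually (eventually_isLocalDiffeomorphAt hf)).and
        (hc.eventually (hf.contMDiffAt.continuousAt (φ'.open_source.mem_nhds hfx))))
  have hform : ∀ z, z ∈ φ.target → IsLocalDiffeomorphAt (𝓡 d) (𝓡 d) 2 f (φ.symm z) →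
      f (φ.symm z) ∈ φ'.source →
      chartDensity (f x) (τ z) * |(fderiv ℝ τ z).det| =
        absDetDeriv d f (φ.symm z) * chartDensity x z := fun z h1 h2 h3 =>
    chartDensity_mul_abs_det_fderiv h1 (h2.mdifferentiableAt two_ne_zero) h3
  have hne : (fderiv ℝ τ (φ x)).det ≠ 0 := fun h0 => by
    obtain ⟨h1, h2, h3⟩ := hev.self_of_nhds
    have h4 := hform _ h1 h2 h3
    rw [h0, abs_zero, mul_zero] at h4
    exact (mul_pos (absDetDeriv_pos two_ne_zero h2) (chartDensity_pos h1)).ne h4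
  refine ((hρ'.mul (hdet.abs hne)).div hρ (chartDensity_pos hy).ne').congr_of_eventuallyEq ?_
  filter_upwards [hev] with z ⟨h1, h2, h3⟩
  exact (eq_div_iff (chartDensity_pos h1).ne').2 (hform z h1 h2 h3).symm

lemma continuousAt_absDetDeriv {x : M} (hf : IsLocalDiffeomorphAt (𝓡 d) (𝓡 d) 2 f x) :
    ContinuousAt (absDetDeriv d f) x := by
  set φ := chartAt 𝔼(d) x with hφ
  have hx : x ∈ φ.source := mem_chart_source _ x
  have h1 := (contDiffAt_absDetDeriv hf).continuousAt.comp (φ.continuousAt hx)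
  refine h1.congr ?_
  filter_upwards [φ.open_source.mem_nhds hx] with y hy
  simp only [Function.comp_apply]
  rw [← hφ, φ.left_inv hy]

end JacobianDeterminant

/-! ### Finiteness, positivity and null sets of the Riemannian volume -/

section VolumeFacts

variable {d : ℕ} {M : Type*} [MetricSpace M] [ChartedSpace 𝔼(d) M]
  [RiemannianBundle (fun x : M => TangentSpace (𝓡 d) x)]
  [IsManifold (𝓡 d) ∞ M]
  [IsContMDiffRiemannianBundle (𝓡 d) ∞ 𝔼(d) (fun x : M => TangentSpace (𝓡 d) x)]
  [MeasurableSpace M] [BorelSpace M]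

lemma setLIntegral_riemannianVolume (x : M) {u : M → ENNReal} {W : Set M}
    (hW : MeasurableSet W) (hWx : W ⊆ (chartAt 𝔼(d) x).source) :
    ∫⁻ p in W, u p ∂(riemannianVolume d M) = ∫⁻ p in W, u p ∂(chartVolume (d := d) x) := by
  have : (riemannianVolume d M).restrict W = (chartVolume (d := d) x).restrict W := by
    ext A hA
    rw [Measure.restrict_apply hA, Measure.restrict_apply hA,
      riemannianVolume_eq_chartVolume x (hA.inter hW) (Set.inter_subset_right.trans hWx)]
  rw [this]

instance isLocallyFiniteMeasure_riemannianVolume :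
    IsLocallyFiniteMeasure (riemannianVolume d M) := by
  refine ⟨fun p => ?_⟩
  set φ := chartAt 𝔼(d) p with hφ
  have hp : p ∈ φ.source := mem_chart_source _ p
  have hcont := (contDiffAt_chartDensity (M := M) (φ.map_source hp)).continuousAt
  have hev : ∀ᶠ y in nhds (φ p), chartDensity p y < chartDensity p (φ p) + 1 :=
    hcont.eventually_lt continuousAt_const (lt_add_one _)
  obtain ⟨r, hr, hball⟩ := Metric.eventually_nhds_iff_ball.1 hev
  let W := φ.source ∩ φ ⁻¹' Metric.ball (φ p) r
  have hWo : IsOpen W := φ.isOpen_inter_preimage Metric.isOpen_ball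
  refine ⟨W, hWo.mem_nhds ⟨hp, Metric.mem_ball_self hr⟩, ?_⟩
  rw [riemannianVolume_eq_chartVolume p hWo.measurableSet Set.inter_subset_left,
    chartVolume_apply p hWo.measurableSet]
  have hsub : φ.target ∩ φ.symm ⁻¹' W ⊆ Metric.ball (φ p) r := fun y hy => by
    have := hy.2.2
    rwa [Set.mem_preimage, φ.right_inv hy.1] at this
  calc ∫⁻ y in φ.target ∩ φ.symm ⁻¹' W, ENNReal.ofReal (chartDensity p y)
      ≤ ∫⁻ y in Metric.ball (φ p) r, ENNReal.ofReal (chartDensity p y) :=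
        lintegral_mono_set hsub
    _ ≤ ∫⁻ y in Metric.ball (φ p) r, ENNReal.ofReal (chartDensity p (φ p) + 1) :=
        setLIntegral_mono measurable_const
          fun y hy => ENNReal.ofReal_le_ofReal (hball y hy).le
    _ < ⊤ := by
        rw [setLIntegral_const]
        exact ENNReal.mul_lt_top ENNReal.ofReal_lt_top measure_ball_lt_top

instance isOpenPosMeasure_riemannianVolume :
    (riemannianVolume d M).IsOpenPosMeasure := by
  refine ⟨fun U hU ⟨p, hp⟩ h0 => ?_⟩
  set φ := chartAt 𝔼(d) p with hφ
  have hps : p ∈ φ.source := mem_chart_source _ p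
  have hWo : IsOpen (U ∩ φ.source) := hU.inter φ.open_source
  have h1 : riemannianVolume d M (U ∩ φ.source) = 0 :=
    measure_mono_null Set.inter_subset_left h0
  rw [riemannianVolume_eq_chartVolume p hWo.measurableSet Set.inter_subset_right,
    chartVolume_apply p hWo.measurableSet] at h1
  have hO : IsOpen (φ.target ∩ φ.symm ⁻¹' (U ∩ φ.source)) := φ.symm.isOpen_inter_preimage hWo
  have hne : (φ.target ∩ φ.symm ⁻¹' (U ∩ φ.source)).Nonempty :=
    ⟨φ p, φ.map_source hps, by
      rw [Set.mem_preimage, φ.left_inv hps]; exact ⟨hp, hps⟩⟩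
  have hmeas : AEMeasurable (fun y => ENNReal.ofReal (chartDensity p y))
      ((volume : Measure 𝔼(d)).restrict (φ.target ∩ φ.symm ⁻¹' (U ∩ φ.source))) :=
    (((continuousOn_chartDensity p).mono Set.inter_subset_left).aemeasurable
      hO.measurableSet).ennreal_ofReal
  rw [lintegral_eq_zero_iff' hmeas] at h1
  have h2 : ∀ᵐ y ∂((volume : Measure 𝔼(d)).restrict
      (φ.target ∩ φ.symm ⁻¹' (U ∩ φ.source))), False := by
    filter_upwards [h1, ae_restrict_mem hO.measurableSet] with y hy hyO
    have := ENNReal.ofReal_eq_zero.1 hy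
    exact absurd (chartDensity_pos (M := M) hyO.1) (not_lt.2 this)
  have h3 : (volume : Measure 𝔼(d)).restrict (φ.target ∩ φ.symm ⁻¹' (U ∩ φ.source)) = 0 := by
    simpa using h2
  rw [Measure.restrict_eq_zero] at h3
  exact (hO.measure_pos volume hne).ne' h3

/-- In a chart, a submanifold of positive codimension is locally contained in the image of a
coordinate hyperplane under a differentiable map, so it has volume zero. -/
lemma riemannianVolume_submanifold [CompactSpace M] {S : Set M}
    (hS : IsCompactProperSubmanifold d S) : riemannianVolume d M S = 0 := by
  refine hS.isCompact.measure_zero_of_nhdsWithin fun p hp => ?_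
  obtain ⟨k, hk, e, he, hpe, hslice⟩ := hS.exists_slice_chart p hp
  set φ := chartAt 𝔼(d) p with hφ
  have hps : p ∈ φ.source := mem_chart_source _ p
  set N := e.source ∩ φ.source with hN
  have hNo : IsOpen N := e.open_source.inter φ.open_source
  refine ⟨S ∩ N, inter_mem_nhdsWithin S (hNo.mem_nhds ⟨hpe, hps⟩), ?_⟩
  have hm : MeasurableSet (S ∩ N) := hS.isCompact.measurableSet.inter hNo.measurableSet
  rw [riemannianVolume_eq_chartVolume p hm (fun q hq => hq.2.2), chartVolume_apply p hm]
  let i : Fin d := ⟨k, hk⟩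
  let L : Submodule ℝ 𝔼(d) := LinearMap.ker (EuclideanSpace.proj i : 𝔼(d) →L[ℝ] ℝ).toLinearMap
  have hL : (volume : Measure 𝔼(d)) (L : Set 𝔼(d)) = 0 := by
    refine Measure.addHaar_submodule _ _ fun h => ?_
    have : EuclideanSpace.single i (1 : ℝ) ∈ L := by rw [h]; trivial
    simp [L] at this
  let A : Set 𝔼(d) := e.target ∩ e.symm ⁻¹' φ.source
  have hdiff : DifferentiableOn ℝ (fun z => φ (e.symm z)) ((L : Set 𝔼(d)) ∩ A) := fun z hz => by
    have h1 : ContMDiffAt (𝓡 d) (𝓡 d) ∞ e.symm z :=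
      (contMDiffOn_symm_of_mem_maximalAtlas he).contMDiffAt (e.open_target.mem_nhds hz.2.1)
    have h2 : ContMDiffAt (𝓡 d) (𝓡 d) ∞ φ (e.symm z) := contMDiffAt_chartAt hz.2.2
    have h3 : ContMDiffAt (𝓡 d) (𝓡 d) ∞ (fun z => φ (e.symm z)) z :=
      ContMDiffAt.comp z h2 h1
    exact (h3.contDiffAt.differentiableAt (by simp)).differentiableWithinAt
  have hnull := addHaar_image_eq_zero_of_differentiableOn_of_addHaar_eq_zero volume hdiff
    (measure_mono_null Set.inter_subset_left hL)
  refine setLIntegral_measure_zero _ _ (measure_mono_null ?_ hnull)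
  rintro y ⟨hy, hyS, hye, hyφ⟩
  refine ⟨e (φ.symm y), ⟨?_, e.map_source hye, ?_⟩, ?_⟩
  · have := (hslice _ hye).1 hyS i le_rfl
    simpa [L] using this
  · rwa [Set.mem_preimage, e.left_inv hye]
  · simp only
    rw [e.left_inv hye, φ.right_inv hy]


variable (d) in
/-- The Jacobian of `f` off `S`, extended by `0`, with values in `[0, ∞]`. -/
noncomputable def jacobian (f : M → M) (S : Set M) : M → ENNReal :=
  Sᶜ.indicator fun x => ENNReal.ofReal (absDetDeriv d f x)

lemma measurable_jacobian {f : M → M} {S : Set M} (hS : IsClosed S)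
    (hfS : IsLocalDiffeomorphOn (𝓡 d) (𝓡 d) 2 f Sᶜ) : Measurable (jacobian d f S) := by
  have h : ContinuousOn (fun x => ENNReal.ofReal (absDetDeriv d f x)) Sᶜ := fun x hx =>
    (ENNReal.continuous_ofReal.continuousAt.comp
      (continuousAt_absDetDeriv (hfS ⟨x, hx⟩))).continuousWithinAt
  rw [jacobian]
  classical
  rw [← Set.piecewise_eq_indicator]
  exact h.measurable_piecewise continuousOn_const hS.isOpen_compl.measurableSet

end VolumeFacts

/-! ### Change of variables -/

section IteratedJacobian

variable {X : Type*} [MetricSpace X] [MeasurableSpace X] [BorelSpace X]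

lemma measurableSet_image_of_injOn [CompactSpace X] {f : X → X} (hf : Continuous f) {W : Set X}
    (hW : MeasurableSet W) (hinj : Set.InjOn f W) : MeasurableSet (f '' W) := by
  exact hW.image_of_continuousOn_injOn hf.continuousOn hinj

variable {m : Measure X} {f : X → X} {E : Set X} {J : X → ENNReal}

lemma setLIntegral_image_of_injOn (hf : Continuous f) (hJ : Measurable J)
    (himg : ∀ W, MeasurableSet W → W ⊆ E → Set.InjOn f W → m (f '' W) = ∫⁻ x in W, J x ∂m)
    {W : Set X} (hW : MeasurableSet W) (hWE : W ⊆ E) (hinj : Set.InjOn f W) {u : X → ENNReal}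
    (hu : Measurable u) : ∫⁻ y in f '' W, u y ∂m = ∫⁻ x in W, u (f x) * J x ∂m := by
  have h : m.restrict (f '' W) = ((m.restrict W).withDensity J).map f := by
    ext A hA
    have hfA := hf.measurable hA
    rw [Measure.restrict_apply hA, Measure.map_apply hf.measurable hA,
      withDensity_apply _ hfA, Measure.restrict_restrict hfA, Set.inter_comm A,
      ← Set.image_inter_preimage, Set.inter_comm]
    exact himg _ (hfA.inter hW) (Set.inter_subset_right.trans hWE)
      (hinj.mono Set.inter_subset_right)
  rw [h, lintegral_map hu hf.measurable]
  refine (lintegral_withDensity_eq_lintegral_mul _ hJ (hu.comp hf.measurable)).trans ?_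
  exact lintegral_congr fun x => mul_comm _ _

/-- The change of variables formula for an iterate of `f`. -/
lemma measure_iterate_image [CompactSpace X] (hf : Continuous f) (hJ : Measurable J)
    (himg : ∀ W, MeasurableSet W → W ⊆ E → Set.InjOn f W → m (f '' W) = ∫⁻ x in W, J x ∂m)
    (n : ℕ) : ∀ {W : Set X}, MeasurableSet W → (∀ i < n, Set.MapsTo f^[i] W E) →
      Set.InjOn f^[n] W →
      m (f^[n] '' W) = ∫⁻ x in W, ∏ i ∈ Finset.range n, J (f^[i] x) ∂m := by
  induction n with
  | zero => intro W _ _ _; simp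
  | succ n ih =>
    intro W hW hWE hinj
    have hinj1 : Set.InjOn f W := fun x hx y hy hxy => hinj hx hy (by
      rw [Function.iterate_succ_apply, Function.iterate_succ_apply, hxy])
    have hfW := measurableSet_image_of_injOn hf hW hinj1
    have h1 : f^[n + 1] '' W = f^[n] '' (f '' W) := by
      rw [← Set.image_comp, ← Function.iterate_succ]
    have hinj2 : Set.InjOn f^[n] (f '' W) := by
      rintro _ ⟨x, hx, rfl⟩ _ ⟨y, hy, rfl⟩ hxy
      rw [hinj hx hy hxy]
    have hE2 : ∀ i < n, Set.MapsTo f^[i] (f '' W) E := by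
      rintro i hi _ ⟨x, hx, rfl⟩
      exact hWE (i + 1) (by omega) hx
    have hmeas : Measurable fun x => ∏ i ∈ Finset.range n, J (f^[i] x) :=
      Finset.measurable_prod _ fun i _ => hJ.comp (hf.iterate i).measurable
    rw [h1, ih hfW hE2 hinj2, setLIntegral_image_of_injOn hf hJ himg hW
      (fun x hx => hWE 0 (Nat.succ_pos n) hx) hinj1 hmeas]
    simp only [Finset.prod_range_succ', Function.iterate_succ_apply, Function.iterate_zero_apply]

end IteratedJacobian

section ChangeOfVariables

variable {d : ℕ} {M : Type*} [MetricSpace M] [CompactSpace M] [ChartedSpace 𝔼(d) M]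
  [RiemannianBundle (fun x : M => TangentSpace (𝓡 d) x)]
  [IsManifold (𝓡 d) ∞ M]
  [IsContMDiffRiemannianBundle (𝓡 d) ∞ 𝔼(d) (fun x : M => TangentSpace (𝓡 d) x)]
  [MeasurableSpace M] [BorelSpace M]

/-- The change of variables formula for `f` off `S`. It is local, and holds on the pieces that `f` maps
from one chart domain to another. -/
lemma riemannianVolume_image {f : M → M} {S : Set M} (hf : Continuous f) (hS : IsClosed S)
    (hfS : IsLocalDiffeomorphOn (𝓡 d) (𝓡 d) 2 f Sᶜ) {W : Set M} (hW : MeasurableSet W)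
    (hWS : W ⊆ Sᶜ) (hinj : Set.InjOn f W) :
    riemannianVolume d M (f '' W) = ∫⁻ x in W, jacobian d f S x ∂(riemannianVolume d M) := by
  have hJ := measurable_jacobian hS hfS
  have key : ∃ V : Set M, MeasurableSet V ∧ Set.univ ⊆ V ∧ ∀ W' ⊆ W ∩ V, MeasurableSet W' →
      riemannianVolume d M (f '' W') =
        ∫⁻ x in W', jacobian d f S x ∂(riemannianVolume d M) := by
    refine isCompact_univ.induction_on (p := fun s => ∃ V : Set M, MeasurableSet V ∧ s ⊆ V ∧
      ∀ W' ⊆ W ∩ V, MeasurableSet W' → riemannianVolume d M (f '' W') =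
        ∫⁻ x in W', jacobian d f S x ∂(riemannianVolume d M)) ?_ ?_ ?_ ?_
    · refine ⟨∅, MeasurableSet.empty, Set.Subset.rfl, fun W' hW' _ => ?_⟩
      rw [Set.inter_empty, Set.subset_empty_iff] at hW'
      simp [hW']
    · rintro s t hst ⟨V, hV, htV, h⟩
      exact ⟨V, hV, hst.trans htV, h⟩
    · rintro s t ⟨V, hV, hsV, h⟩ ⟨V', hV', htV', h'⟩
      refine ⟨V ∪ V', hV.union hV', Set.union_subset_union hsV htV', fun W' hW' hm => ?_⟩
      have e1 := h (W' ∩ V) (fun x hx => ⟨(hW' hx.1).1, hx.2⟩) (hm.inter hV)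
      have e2 := h' (W' \ V) (fun x hx => ⟨(hW' hx.1).1, (hW' hx.1).2.resolve_left hx.2⟩)
        (hm.diff hV)
      have hi : Set.InjOn f W' := hinj.mono fun x hx => (hW' hx).1
      rw [← lintegral_inter_add_sdiff _ _ hV, ← e1, ← e2, ← measure_union,
        ← Set.image_union, Set.inter_union_sdiff]
      · rw [Set.disjoint_left]
        rintro _ ⟨y, hy, rfl⟩ ⟨z, hz, hzy⟩
        exact hz.2 (hi hz.1 hy.1 hzy ▸ hy.2)
      · exact measurableSet_image_of_injOn hf (hm.diff hV) (hi.mono Set.sdiff_subset)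
    · intro x _
      set O := (chartAt 𝔼(d) x).source ∩ f ⁻¹' (chartAt 𝔼(d) (f x)).source with hO
      have hOo : IsOpen O := (chartAt 𝔼(d) x).open_source.inter
        ((chartAt 𝔼(d) (f x)).open_source.preimage hf)
      refine ⟨O, mem_nhdsWithin_of_mem_nhds
        (hOo.mem_nhds ⟨mem_chart_source _ x, mem_chart_source _ (f x)⟩), O, hOo.measurableSet,
        Set.Subset.rfl, fun W' hW' hm => ?_⟩
      have hi : Set.InjOn f W' := hinj.mono fun x hx => (hW' hx).1
      have hfm := measurableSet_image_of_injOn hf hm hi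
      have hto : Set.MapsTo f W' (chartAt 𝔼(d) (f x)).source := fun y hy => (hW' hy).2.2
      have hs : W' ⊆ (chartAt 𝔼(d) x).source := fun y hy => (hW' hy).2.1
      rw [riemannianVolume_eq_chartVolume (f x) hfm hto.image_subset,
        setLIntegral_riemannianVolume x hm hs]
      refine chartVolume_image hm hs (fun p hp => ?_) hto hi hfm hJ fun p hp => ?_
      · exact (hfS ⟨p, hWS (hW' hp).1⟩).mdifferentiableAt two_ne_zero
      · exact Set.indicator_of_mem (hWS (hW' hp).1) _
  obtain ⟨V, -, hV, h⟩ := key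
  exact h W (fun x hx => ⟨hx, hV trivial⟩) hW

instance isProbabilityMeasure_lebesgue [Nonempty M] : IsProbabilityMeasure (lebesgue d M) :=
  ⟨by
    rw [lebesgue, Measure.smul_apply, smul_eq_mul]
    exact ENNReal.inv_mul_cancel (isOpen_univ.measure_pos _ Set.univ_nonempty).ne'
      (measure_ne_top _ _)⟩

instance isOpenPosMeasure_lebesgue : (lebesgue d M).IsOpenPosMeasure := by
  refine ⟨fun U hU hne => ?_⟩
  rw [lebesgue, Measure.smul_apply, smul_eq_mul]
  exact mul_ne_zero (ENNReal.inv_ne_zero.2 (measure_ne_top _ _)) (hU.measure_pos _ hne).ne'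

lemma lebesgue_submanifold {S : Set M} (hS : IsCompactProperSubmanifold d S) :
    lebesgue d M S = 0 := by
  rw [lebesgue, Measure.smul_apply, riemannianVolume_submanifold hS, smul_zero]

lemma lebesgue_image {f : M → M} {S : Set M} (hf : Continuous f) (hS : IsClosed S)
    (hfS : IsLocalDiffeomorphOn (𝓡 d) (𝓡 d) 2 f Sᶜ) {W : Set M} (hW : MeasurableSet W)
    (hWS : W ⊆ Sᶜ) (hinj : Set.InjOn f W) :
    lebesgue d M (f '' W) = ∫⁻ x in W, jacobian d f S x ∂(lebesgue d M) := by
  rw [lebesgue, Measure.smul_apply, riemannianVolume_image hf hS hfS hW hWS hinj,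
    Measure.restrict_smul, lintegral_smul_measure]

/-- `f` is non-singular: preimages of null sets are null sets. -/
lemma map_lebesgue_absolutelyContinuous {f : M → M} {S : Set M} (hf : Continuous f)
    (hS : IsCompactProperSubmanifold d S) (hfS : IsLocalDiffeomorphOn (𝓡 d) (𝓡 d) 2 f Sᶜ) :
    (lebesgue d M).map f ≪ lebesgue d M := by
  have hSc := hS.isCompact.isClosed
  refine Measure.AbsolutelyContinuous.mk fun A hA h0 => ?_
  rw [Measure.map_apply hf.measurable hA]
  have hsub : f ⁻¹' A ⊆ S ∪ (f ⁻¹' A ∩ Sᶜ) := fun x hx => by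
    by_cases h : x ∈ S
    · exact Or.inl h
    · exact Or.inr ⟨hx, h⟩
  refine measure_mono_null hsub (measure_union_null (lebesgue_submanifold hS) ?_)
  refine measure_null_of_locally_null _ fun x hx => ?_
  obtain ⟨Φ, hxΦ, hΦ⟩ := hfS ⟨x, hx.2⟩
  refine ⟨(f ⁻¹' A ∩ Sᶜ) ∩ Φ.source, inter_mem_nhdsWithin _ (Φ.open_source.mem_nhds hxΦ), ?_⟩
  set W := (f ⁻¹' A ∩ Sᶜ) ∩ Φ.source with hWdef
  have hW : MeasurableSet W := ((hf.measurable hA).inter hSc.measurableSet.compl).inter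
    Φ.open_source.measurableSet
  have hinj : Set.InjOn f W := fun y hy z hz hyz => by
    rw [hΦ hy.2, hΦ hz.2] at hyz
    exact Φ.toPartialEquiv.injOn hy.2 hz.2 hyz
  have h1 := lebesgue_image hf hSc hfS hW (fun y hy => hy.1.2) hinj
  have h2 : lebesgue d M (f '' W) = 0 := measure_mono_null (by
    rintro _ ⟨y, hy, rfl⟩
    exact hy.1.1) h0
  rw [h2, eq_comm, lintegral_eq_zero_iff (measurable_jacobian hSc hfS)] at h1
  have h3 : ∀ᵐ y ∂((lebesgue d M).restrict W), False := by
    filter_upwards [h1, ae_restrict_mem hW] with y hy hyW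
    have h4 : jacobian d f S y = ENNReal.ofReal (absDetDeriv d f y) :=
      Set.indicator_of_mem hyW.1.2 _
    rw [h4] at hy
    exact absurd (absDetDeriv_pos two_ne_zero (hfS ⟨y, hyW.1.2⟩))
      (not_lt.2 (ENNReal.ofReal_eq_zero.1 hy))
  have h5 : (lebesgue d M).restrict W = 0 := by simpa using h3
  rwa [Measure.restrict_eq_zero] at h5

end ChangeOfVariables

/-! ### Uniform control of the derivative near the points of a hyperbolic orbit -/

section Control

lemma mul_le_infDist_of_le_truncDist {M : Type*} [MetricSpace M] {S : Set M}
    (hS : S.Nonempty) {a δ : ℝ} (ha0 : 0 ≤ a) (ha : a ≤ 1)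
    (hδ : 0 < δ) {x : M} (h : a ≤ truncDist δ S x) : min δ 1 * a ≤ Metric.infDist x S := by
  rw [truncDist] at h
  split_ifs at h with h1
  · exact (mul_le_of_le_one_left ha0 (min_le_right _ _)).trans h
  · have : δ < Metric.infDist x S := by
      by_contra! h2
      exact h1 ⟨hS, h2⟩
    calc min δ 1 * a ≤ δ * 1 := mul_le_mul (min_le_left _ _) ha ha0 hδ.le
      _ ≤ _ := by linarith

variable {d : ℕ} {M : Type*} [MetricSpace M] [ChartedSpace 𝔼(d) M]
  [RiemannianBundle (fun x : M => TangentSpace (𝓡 d) x)]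
  [IsManifold (𝓡 d) ∞ M]
  [IsContMDiffRiemannianBundle (𝓡 d) ∞ 𝔼(d) (fun x : M => TangentSpace (𝓡 d) x)]
  {f : M → M} {S : Set M} {B β b q σ δ : ℝ}

lemma exists_nhds_normDerivInv_le {p : M} (hf : IsLocalDiffeomorphAt (𝓡 d) (𝓡 d) 2 f p)
    (hq : 0 < q) (hq1 : q < 1) :
    ∃ N ∈ nhds p, ∀ x ∈ N, ∀ y ∈ N, normDerivInv d f y ≤ (q ^ 2)⁻¹ * normDerivInv d f x := by
  rcases Nat.eq_zero_or_pos d with rfl | hd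
  -- in dimension `0` all these norms vanish, but then the points are isolated
  · refine ⟨(chartAt 𝔼(0) p).source, (chartAt 𝔼(0) p).open_source.mem_nhds
      (mem_chart_source _ p), fun x hx y hy => ?_⟩
    have : x = y := (chartAt 𝔼(0) p).injOn hx hy (Subsingleton.elim _ _)
    subst this
    refine le_mul_of_one_le_left (normDerivInv_nonneg f x) ?_
    exact (one_le_inv₀ (by positivity)).2 (pow_le_one₀ hq.le hq1.le)
  · have hpos := normDerivInv_pos hd two_ne_zero hf
    have hc := continuousAt_normDerivInv (by norm_num) hf
    have h1 : ∀ᶠ y in nhds p, q * normDerivInv d f p < normDerivInv d f y :=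
      continuousAt_const.eventually_lt hc (mul_lt_of_lt_one_left hpos hq1)
    have h2 : ∀ᶠ y in nhds p, normDerivInv d f y < q⁻¹ * normDerivInv d f p :=
      hc.eventually_lt continuousAt_const
        (lt_mul_of_one_lt_left hpos ((one_lt_inv₀ hq).2 hq1))
    refine ⟨_, h1.and h2, fun x hx y hy => ?_⟩
    calc normDerivInv d f y ≤ q⁻¹ * normDerivInv d f p := hy.2.le
      _ = (q ^ 2)⁻¹ * (q * normDerivInv d f p) := by field_simp
      _ ≤ (q ^ 2)⁻¹ * normDerivInv d f x := by
        gcongr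
        exact hx.1.le

lemma exists_nhds_abs_log_absDetDeriv_sub_le [IsRiemannianManifold (𝓡 d) M] {p : M}
    (hf : IsLocalDiffeomorphAt (𝓡 d) (𝓡 d) 2 f p) :
    ∃ C : ℝ, ∃ N ∈ nhds p, ∀ x ∈ N, ∀ y ∈ N,
      |Real.log (absDetDeriv d f y) - Real.log (absDetDeriv d f x)| ≤ C * dist y x := by
  set φ := chartAt 𝔼(d) p with hφ
  have hp : p ∈ φ.source := mem_chart_source _ p
  have hpos : absDetDeriv d f (φ.symm (φ p)) ≠ 0 := by
    rw [φ.left_inv hp]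
    exact (absDetDeriv_pos two_ne_zero hf).ne'
  obtain ⟨K, T, hT, hK⟩ := ((contDiffAt_absDetDeriv hf).log hpos).exists_lipschitzOnWith
  obtain ⟨C, hC, N, hN, hCN⟩ := exists_nhds_dist_chartAt_le (d := d) p
  refine ⟨K * C, (N ∩ φ ⁻¹' T) ∩ φ.source, inter_mem (inter_mem hN (φ.continuousAt hp hT))
    (φ.open_source.mem_nhds hp), fun x hx y hy => ?_⟩
  have h1 := hK.dist_le_mul _ hy.1.2 _ hx.1.2
  simp only [← hφ] at h1
  rw [φ.left_inv hx.2, φ.left_inv hy.2, Real.dist_eq] at h1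
  refine h1.trans ?_
  rw [mul_assoc]
  exact mul_le_mul_of_nonneg_left (hCN y hy.1.1 x hx.1.1) K.coe_nonneg

/-- The control off the exceptional set when this set is empty, by compactness. -/
lemma exists_control_of_isLocalDiffeomorph [CompactSpace M] [IsRiemannianManifold (𝓡 d) M]
    (hf : ∀ p, IsLocalDiffeomorphAt (𝓡 d) (𝓡 d) 2 f p) (hq : 0 < q) (hq1 : q < 1) :
    ∃ r > 0, ∃ C : ℝ, 0 ≤ C ∧ ∀ x y : M, dist y x ≤ r →
      normDerivInv d f y ≤ (q ^ 2)⁻¹ * normDerivInv d f x ∧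
      |Real.log (absDetDeriv d f y) - Real.log (absDetDeriv d f x)| ≤ C * dist y x := by
  have key : ∃ r > 0, ∃ C : ℝ, 0 ≤ C ∧ ∀ x ∈ (Set.univ : Set M), ∀ y : M, dist y x ≤ r →
      normDerivInv d f y ≤ (q ^ 2)⁻¹ * normDerivInv d f x ∧
      |Real.log (absDetDeriv d f y) - Real.log (absDetDeriv d f x)| ≤ C * dist y x := by
    refine isCompact_univ.induction_on (p := fun s : Set M => ∃ r > 0, ∃ C : ℝ, 0 ≤ C ∧
      ∀ x ∈ s, ∀ y : M, dist y x ≤ r → normDerivInv d f y ≤ (q ^ 2)⁻¹ * normDerivInv d f x ∧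
      |Real.log (absDetDeriv d f y) - Real.log (absDetDeriv d f x)| ≤ C * dist y x) ?_ ?_ ?_ ?_
    · exact ⟨1, one_pos, 0, le_rfl, by simp⟩
    · rintro s t hst ⟨r, hr, C, hC, h⟩
      exact ⟨r, hr, C, hC, fun x hx => h x (hst hx)⟩
    · rintro s t ⟨r, hr, C, hC, h⟩ ⟨r', hr', C', hC', h'⟩
      refine ⟨min r r', lt_min hr hr', max C C', le_max_of_le_left hC, ?_⟩
      rintro x (hx | hx) y hy
      · obtain ⟨h1, h2⟩ := h x hx y (hy.trans (min_le_left _ _))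
        exact ⟨h1, h2.trans (mul_le_mul_of_nonneg_right (le_max_left _ _) dist_nonneg)⟩
      · obtain ⟨h1, h2⟩ := h' x hx y (hy.trans (min_le_right _ _))
        exact ⟨h1, h2.trans (mul_le_mul_of_nonneg_right (le_max_right _ _) dist_nonneg)⟩
    · intro p _
      obtain ⟨N, hN, h1⟩ := exists_nhds_normDerivInv_le (hf p) hq hq1
      obtain ⟨C, N', hN', h2⟩ := exists_nhds_abs_log_absDetDeriv_sub_le (hf p)
      obtain ⟨r, hr, hball⟩ := Metric.mem_nhds_iff.1 (inter_mem hN hN')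
      refine ⟨Metric.ball p (r / 2), mem_nhdsWithin_of_mem_nhds (Metric.ball_mem_nhds p
        (by positivity)), r / 3, by positivity, |C|, abs_nonneg _, fun x hx y hy => ?_⟩
      have hx' : x ∈ Metric.ball p r := Metric.ball_subset_ball (by linarith) hx
      have hy' : y ∈ Metric.ball p r := by
        rw [Metric.mem_ball] at hx ⊢
        linarith [dist_triangle y x p]
      refine ⟨h1 x (hball hx').1 y (hball hy').1, (h2 x (hball hx').2 y (hball hy').2).trans ?_⟩
      exact mul_le_mul_of_nonneg_right (le_abs_self C) dist_nonneg
  obtain ⟨r, hr, C, hC, h⟩ := key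
  exact ⟨r, hr, C, hC, fun x => h x trivial⟩

/-- If `x` is not too close to `S` at scale `k`, then on the ball of radius `r σ ^ (k / 2)` around
`x` the map `f` contracts at most `σ ^ (-1 / 2)` times less than at `x`, and the oscillation
of `log |det Df|` is at most `C σ ^ (k / 4)`. Here `q = σ ^ (1 / 4)`. -/
lemma exists_uniform_control [CompactSpace M] [IsRiemannianManifold (𝓡 d) M]
    (hS : IsCompactProperSubmanifold d S) (hfS : IsLocalDiffeomorphOn (𝓡 d) (𝓡 d) 2 f Sᶜ)
    (hnd : IsNondegenerate d f S B β) (hb : b < 1 / 2) (hbβ : b * β < 1 / 4) (hb0 : 0 < b)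
    (hq : 0 < q) (hq1 : q < 1) (hσ : σ = q ^ 4) (hδ : 0 < δ) :
    ∃ r > 0, ∃ C : ℝ, 0 ≤ C ∧ ∀ (k : ℕ) (x : M), σ ^ (b * k) ≤ truncDist δ S x →
      ∀ y : M, dist y x ≤ r * (q ^ 2) ^ k → y ∉ S ∧
        normDerivInv d f y ≤ (q ^ 2)⁻¹ * normDerivInv d f x ∧
        |Real.log (absDetDeriv d f y) - Real.log (absDetDeriv d f x)| ≤ C * q ^ k := by
  have hqk : ∀ k : ℕ, (q ^ 2) ^ k = q ^ k * q ^ k := fun k => by rw [← mul_pow, sq]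
  rcases S.eq_empty_or_nonempty with rfl | hne
  · obtain ⟨r, hr, C, hC, h⟩ := exists_control_of_isLocalDiffeomorph (f := f)
      (fun p => hfS ⟨p, by simp⟩) hq hq1
    refine ⟨r, hr, C * r, by positivity, fun k x _ y hy => ⟨by simp, ?_⟩⟩
    have hk1 : q ^ k ≤ 1 := pow_le_one₀ hq.le hq1.le
    have hk0 : 0 < q ^ k := by positivity
    obtain ⟨h1, h2⟩ := h x y (hy.trans (by
      rw [hqk]
      exact mul_le_of_le_one_right hr.le (mul_le_one₀ hk1 hk0.le hk1)))
    refine ⟨h1, h2.trans ?_⟩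
    rw [mul_assoc]
    refine mul_le_mul_of_nonneg_left (hy.trans ?_) hC
    rw [hqk]
    exact mul_le_mul_of_nonneg_left (mul_le_of_le_one_right hk0.le hk1) hr.le
  · have hd : 0 < d := by
      obtain ⟨p, hp⟩ := hne
      obtain ⟨k, hk, -⟩ := hS.exists_slice_chart p hp
      omega
    have hβ := hnd.pos
    have hB : 0 < B := one_pos.trans hnd.one_lt
    set c := min δ 1 with hc
    have hc0 : 0 < c := lt_min hδ one_pos
    have hcβ : 0 < c ^ β := Real.rpow_pos_of_pos hc0 β
    have hlog : 0 < -Real.log (q ^ 2) := by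
      have := Real.log_neg (pow_pos hq 2) (pow_lt_one₀ hq.le hq1 two_ne_zero)
      linarith
    -- `r` keeps the ball away from `S`, and the oscillation of `log ‖Df⁻¹‖` below `log q⁻²`
    set r := min (c / 4) (c ^ β / B * (-Real.log (q ^ 2))) with hr
    have hr0 : 0 < r := lt_min (by positivity) (by positivity)
    refine ⟨r, hr0, B / c ^ β * r, by positivity, fun k x hx y hy => ?_⟩
    have hk1 : q ^ k ≤ 1 := pow_le_one₀ hq.le hq1.le
    have hk0 : 0 < q ^ k := by positivity
    have hσ0 : 0 < σ := hσ ▸ by positivity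
    have hσ1 : σ ≤ 1 := hσ ▸ pow_le_one₀ hq.le hq1.le
    have hD := mul_le_infDist_of_le_truncDist hne (Real.rpow_nonneg hσ0.le (b * k))
      (Real.rpow_le_one hσ0.le hσ1 (by positivity)) hδ hx
    rw [← hc] at hD
    set D := Metric.infDist x S with hDdef
    have hσk : ∀ a : ℝ, σ ^ (a * k) = q ^ (4 * a * k) := fun a => by
      rw [hσ, ← Real.rpow_natCast q 4, ← Real.rpow_mul hq.le]
      congr 1
      push_cast
      ring
    -- `b < 1 / 2`: the radius `σ ^ (k / 2)` is small compared with the distance to `S`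
    have hs : (q ^ 2) ^ k ≤ σ ^ (b * k) := by
      rw [hσk, ← pow_mul, ← Real.rpow_natCast]
      refine Real.rpow_le_rpow_of_exponent_ge hq hq1.le ?_
      push_cast
      nlinarith [(Nat.cast_nonneg k : (0 : ℝ) ≤ k)]
    -- `b β < 1 / 4`: the factor `D ^ (-β)` costs at most `σ ^ (-k / 4)`
    have hDβ : c ^ β * q ^ k ≤ D ^ β := by
      calc c ^ β * q ^ k ≤ c ^ β * (σ ^ (b * k)) ^ β := by
            refine mul_le_mul_of_nonneg_left ?_ hcβ.le
            rw [hσk, ← Real.rpow_mul hq.le, ← Real.rpow_natCast]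
            refine Real.rpow_le_rpow_of_exponent_ge hq hq1.le ?_
            nlinarith [(Nat.cast_nonneg k : (0 : ℝ) ≤ k)]
        _ = (c * σ ^ (b * k)) ^ β := (Real.mul_rpow hc0.le (Real.rpow_nonneg hσ0.le _)).symm
        _ ≤ D ^ β := Real.rpow_le_rpow (by positivity) hD hβ.le
    have hD0 : 0 < D := lt_of_lt_of_le (by positivity) hD
    have hxy : dist x y < D / 2 := by
      rw [dist_comm]
      calc dist y x ≤ r * (q ^ 2) ^ k := hy
        _ ≤ c / 4 * σ ^ (b * k) :=
          mul_le_mul (min_le_left _ _) hs (by positivity) (by positivity)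
        _ = (c * σ ^ (b * k)) / 4 := by ring
        _ < D / 2 := by linarith
    have hxS : x ∉ S := fun h => hD0.ne' (Metric.infDist_zero_of_mem h)
    have hyS : y ∉ S := fun h => by
      have := Metric.infDist_le_dist_of_mem (x := x) h
      linarith
    have hbound : B / D ^ β * dist x y ≤ B / c ^ β * r * q ^ k := by
      calc B / D ^ β * dist x y ≤ B / (c ^ β * q ^ k) * (r * (q ^ 2) ^ k) := by
            rw [dist_comm x y]
            gcongr
        _ = B / c ^ β * r * q ^ k := by
            rw [hqk]
            field_simp
    refine ⟨hyS, ?_, ?_⟩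
    · have h1 := (abs_le.1 ((hnd.norm_lipschitz hne x hxS y hyS hxy).trans hbound)).1
      have h2 : B / c ^ β * r * q ^ k ≤ -Real.log (q ^ 2) := by
        calc B / c ^ β * r * q ^ k
            ≤ B / c ^ β * (c ^ β / B * (-Real.log (q ^ 2))) * 1 := by
              refine mul_le_mul (mul_le_mul_of_nonneg_left (min_le_right _ _) (by positivity))
                hk1 hk0.le (by positivity)
          _ = -Real.log (q ^ 2) := by field_simp
      have hx0 := normDerivInv_pos hd two_ne_zero (hfS ⟨x, hxS⟩)
      have hy0 := normDerivInv_pos hd two_ne_zero (hfS ⟨y, hyS⟩)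
      rw [← Real.log_le_log_iff hy0 (by positivity), Real.log_mul (by positivity) hx0.ne',
        Real.log_inv]
      linarith
    · rw [abs_sub_comm]
      exact (hnd.det_lipschitz hne x hxS y hyS hxy).trans hbound

end Control

/-! ### Contraction along lifted paths -/

section Lifts

variable {X : Type*} [MetricSpace X] {f : X → X}

/-- Let `f` expand by the factor `(K i)⁻¹` near the points that are `ρ s ^ k` close to `f^[i] x`,
`i = n - k`, and let the products of the last `k` constants be at most `s ^ k`. Then a lift of a
`ρ`-Lipschitz path under `f^[n]` starting at `x` stays `ρ s ^ k` close to the orbit of `x` at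
time `n - k`. -/
lemma dist_iterate_le_of_lift (hf : Continuous f) {n : ℕ} {x : X} {K : ℕ → ℝ}
    (hK : ∀ i, 0 ≤ K i) {s ρ : ℝ} (hs : 0 ≤ s) (hρ : 0 ≤ ρ)
    (hprod : ∀ k ≤ n, ∏ i ∈ Finset.Ico (n - k) n, K i ≤ s ^ k)
    (hloc : ∀ k, 1 ≤ k → k ≤ n → ∀ y, dist y (f^[n - k] x) ≤ ρ * s ^ k →
      ∃ N ∈ nhds y, ∀ z ∈ N, ∀ w ∈ N, dist z w ≤ K (n - k) * dist (f z) (f w))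
    {γ : ℝ → X} {T : ℝ} (hT : T ≤ 1)
    (hγ : ∀ t ∈ Set.Icc 0 T, ∀ u ∈ Set.Icc 0 T, dist (γ u) (γ t) ≤ ρ * |u - t|)
    {c : ℝ → X} (hc : ContinuousOn c (Set.Icc 0 T)) (hc0 : c 0 = x)
    (hcγ : ∀ t ∈ Set.Icc 0 T, f^[n] (c t) = γ t) :
    ∀ k ≤ n, ∀ t ∈ Set.Icc 0 T, dist (f^[n - k] (c t)) (f^[n - k] x) ≤ ρ * s ^ k * t := by
  intro k
  induction k using Nat.strong_induction_on with
  | _ k ih =>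
  intro hkn
  have hcont : ∀ j, ContinuousOn (fun t => f^[j] (c t)) (Set.Icc 0 T) := fun j =>
    (hf.iterate j).comp_continuousOn hc
  rcases lt_or_ge T 0 with hT0 | hT0
  · intro t ht
    exact absurd (ht.1.trans ht.2) (not_le.2 hT0)
  set A : Set ℝ := {t | dist (f^[n - k] (c t)) (f^[n - k] x) ≤ ρ * s ^ k * t} with hA
  have hclosed : IsClosed (A ∩ Set.Icc 0 T) := by
    rw [Set.inter_comm]
    exact ContinuousOn.preimage_isClosed_of_isClosed (f := fun t =>
      (dist (f^[n - k] (c t)) (f^[n - k] x), ρ * s ^ k * t))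
      ((continuous_dist.comp_continuousOn ((hcont (n - k)).prodMk continuousOn_const)).prodMk
        (by fun_prop)) isClosed_Icc
      OrderClosedTopology.isClosed_le'
  -- the bound at `t` puts the lift where `f` expands, and so persists a little beyond `t`
  refine hclosed.Icc_subset_of_forall_mem_nhdsWithin (by simp [hA, hc0]) fun t ht => ?_
  have htI : t ∈ Set.Icc 0 T := Set.Ico_subset_Icc_self ht.2
  have ht1 : t ≤ 1 := htI.2.trans hT
  have hclose : ∀ j ≤ k, dist (f^[n - j] (c t)) (f^[n - j] x) ≤ ρ * s ^ j * t := fun j hj => by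
    rcases hj.lt_or_eq with h | rfl
    · exact ih j h (hj.trans hkn) t htI
    · exact ht.1
  -- near time `t`, the lift at time `n - j` moves at most `∏ K` times as fast as `γ`
  have hexp : ∀ j ≤ k, ∀ᶠ u in nhdsWithin t (Set.Icc 0 T),
      dist (f^[n - j] (c u)) (f^[n - j] (c t)) ≤
        (∏ i ∈ Finset.Ico (n - j) n, K i) * dist (γ u) (γ t) := by
    intro j
    induction j with
    | zero =>
      intro _
      filter_upwards [self_mem_nhdsWithin] with u hu
      simp [hcγ u hu, hcγ t htI]
    | succ j ihj =>
      intro hj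
      have hn1 : (n - (j + 1)).succ = n - j := by omega
      obtain ⟨N, hN, hNK⟩ := hloc (j + 1) (by omega) (hj.trans hkn) (f^[n - (j + 1)] (c t))
        ((hclose (j + 1) hj).trans (mul_le_of_le_one_right (by positivity) ht1))
      filter_upwards [ihj (by omega), (hcont (n - (j + 1))) t htI hN] with u hu huN
      have h1 := hNK _ huN _ (mem_of_mem_nhds hN)
      rw [← Function.iterate_succ_apply' f, ← Function.iterate_succ_apply' f, hn1] at h1
      refine h1.trans ?_
      rw [Finset.prod_eq_prod_Ico_succ_bot (by omega : n - (j + 1) < n),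
        show n - (j + 1) + 1 = n - j by omega, mul_assoc]
      exact mul_le_mul_of_nonneg_left hu (hK _)
  have hle : nhdsWithin t (Set.Ioi t) ≤ nhdsWithin t (Set.Icc 0 T) := by
    rw [← nhdsWithin_Ioc_eq_nhdsGT ht.2.2]
    exact nhdsWithin_mono t fun u hu => ⟨ht.2.1.trans hu.1.le, hu.2⟩
  filter_upwards [hle (hexp k le_rfl), hle self_mem_nhdsWithin, self_mem_nhdsWithin]
    with u hu huI htu
  have hut : |u - t| = u - t := abs_of_nonneg (sub_nonneg.2 (le_of_lt htu))
  have hstep : dist (f^[n - k] (c u)) (f^[n - k] (c t)) ≤ s ^ k * (ρ * (u - t)) := by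
    refine hu.trans (mul_le_mul (hprod k hkn) ?_ dist_nonneg (by positivity))
    rw [← hut]
    exact hγ t htI u huI
  have htri := dist_triangle (f^[n - k] (c u)) (f^[n - k] (c t)) (f^[n - k] x)
  have := hclose k le_rfl
  change dist _ _ ≤ _
  nlinarith

end Lifts

/-! ### Summing over inverse branches -/

section Branches

variable {X : Type*} [MetricSpace X] [CompactSpace X] [MeasurableSpace X] [BorelSpace X]

/-- If every point of `Q` that `F` maps into `U` lies on an inverse branch of `F` over `U` on which
the distortion of the measure is bounded by `κ`, then the same bound holds for the whole of `Q`: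
distinct branches have disjoint images. -/
lemma measure_inter_preimage_mul_le {m : Measure X} [IsProbabilityMeasure m] {F : X → X}
    {E : Set X} (hE : IsOpen E) (hF : IsLocalHomeomorphOn F E) {U : Set X} (hU : IsOpen U)
    (hUc : IsPreconnected U) {Q : Set X} {κ : ENNReal} {A : Set X}
    (hbranch : ∀ x ∈ Q, F x ∈ U → ∃ g : X → X, ContinuousOn g U ∧ (∀ u ∈ U, g u ∈ E) ∧
      (∀ u ∈ U, F (g u) = u) ∧ g (F x) = x ∧
      m (g '' U ∩ F ⁻¹' A) * m U ≤ κ * m A * m (g '' U)) :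
    m (Q ∩ F ⁻¹' (A ∩ U)) * m U ≤ κ * m A := by
  choose! g hgc hgE hFg hgx hκ using hbranch
  set P : Set X := {x | x ∈ Q ∧ F x ∈ U} with hP
  set 𝒱 : Set (Set X) := (fun x => g x '' U) '' P with h𝒱
  have hopen : ∀ V ∈ 𝒱, IsOpen V := by
    rintro _ ⟨x, hx, rfl⟩
    exact isOpen_image_section hE hF hU (hgc x hx.1 hx.2) (hgE x hx.1 hx.2) (hFg x hx.1 hx.2)
  have hdisj : 𝒱.PairwiseDisjoint id := by
    rintro _ ⟨x, hx, rfl⟩ _ ⟨x', hx', rfl⟩ hne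
    refine Set.disjoint_left.2 ?_
    rintro _ ⟨u, hu, rfl⟩ ⟨u', hu', huu⟩
    have h1 : u' = u := by
      rw [← hFg x hx.1 hx.2 u hu, ← huu, hFg x' hx'.1 hx'.2 u' hu']
    subst h1
    refine hne (Set.EqOn.image_eq ?_)
    exact eqOn_section_of_eq hE hF hUc (hgc x hx.1 hx.2) (hgc x' hx'.1 hx'.2)
      (hgE x hx.1 hx.2) (hgE x' hx'.1 hx'.2) (hFg x hx.1 hx.2) (hFg x' hx'.1 hx'.2) hu huu.symm
  have hne : ∀ V ∈ 𝒱, (id V).Nonempty := by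
    rintro _ ⟨x, hx, rfl⟩
    exact ⟨_, _, hx.2, rfl⟩
  have hcount : 𝒱.Countable := hdisj.countable_of_isOpen hopen hne
  have hsub : Q ∩ F ⁻¹' (A ∩ U) ⊆ ⋃ V ∈ 𝒱, V ∩ F ⁻¹' A := by
    rintro x ⟨hxQ, hxA, hxU⟩
    refine Set.mem_biUnion ⟨x, ⟨hxQ, hxU⟩, rfl⟩ ⟨⟨F x, hxU, hgx x hxQ hxU⟩, hxA⟩
  have : Countable 𝒱 := hcount.to_subtype
  calc m (Q ∩ F ⁻¹' (A ∩ U)) * m U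
      ≤ (∑' V : 𝒱, m (V ∩ F ⁻¹' A)) * m U := by
        gcongr
        exact (measure_mono hsub).trans (measure_biUnion_le m hcount _)
    _ = ∑' V : 𝒱, m (V ∩ F ⁻¹' A) * m U := ENNReal.tsum_mul_right.symm
    _ ≤ ∑' V : 𝒱, κ * m A * m V := by
        refine ENNReal.tsum_le_tsum ?_
        rintro ⟨_, x, hx, rfl⟩
        exact hκ x hx.1 hx.2
    _ = κ * m A * ∑' V : 𝒱, m V := ENNReal.tsum_mul_left
    _ = κ * m A * m (⋃ V ∈ 𝒱, V) := by
        exact congrArg _ (measure_biUnion (f := id) hcount hdisj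
          fun V hV => (hopen V hV).measurableSet).symm
    _ ≤ κ * m A * 1 := by
        gcongr
        exact prob_le_one
    _ = κ * m A := mul_one _

end Branches

/-! ### Inverse branches at hyperbolic times -/

section IterateLocalHomeomorph

variable {X : Type*} [TopologicalSpace X] {f : X → X} {E : Set X}

lemma isOpen_iterate_mem (hf : Continuous f) (hE : IsOpen E) (n : ℕ) :
    IsOpen {y | ∀ i < n, f^[i] y ∈ E} := by
  have : {y | ∀ i < n, f^[i] y ∈ E} = ⋂ i ∈ Finset.range n, f^[i] ⁻¹' E := by
    ext y
    simp
  rw [this]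
  exact isOpen_biInter_finset fun i _ => hE.preimage (hf.iterate i)

lemma isLocalHomeomorphOn_iterate (hE : IsLocalHomeomorphOn f E) (n : ℕ) :
    IsLocalHomeomorphOn f^[n] {y | ∀ i < n, f^[i] y ∈ E} := by
  induction n with
  | zero => exact (Homeomorph.refl X).isLocalHomeomorph.isLocalHomeomorphOn
  | succ n ih =>
    rw [Function.iterate_succ']
    refine hE.comp (ih.mono fun y hy i hi => hy i (hi.trans (Nat.lt_succ_self n))) fun y hy => ?_
    exact hy n (Nat.lt_succ_self n)

end IterateLocalHomeomorph

section InverseBranches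

/-- Every point has a small connected neighbourhood that is contracted to each of its points along
`ρ`-Lipschitz paths, the segments of a chart. -/
lemma exists_isOpen_contraction (d : ℕ) {M : Type*} [MetricSpace M] [ChartedSpace 𝔼(d) M]
    [RiemannianBundle (fun x : M => TangentSpace (𝓡 d) x)] [IsManifold (𝓡 d) ∞ M]
    [IsContMDiffRiemannianBundle (𝓡 d) ∞ 𝔼(d) (fun x : M => TangentSpace (𝓡 d) x)]
    [IsRiemannianManifold (𝓡 d) M] (p : M) {ρ : ℝ} (hρ : 0 < ρ) :
    ∃ U : Set M, IsOpen U ∧ p ∈ U ∧ IsPreconnected U ∧ ∀ a ∈ U, ∃ H : ℝ → M → M,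
      ContinuousOn (fun z : ℝ × M => H z.1 z.2) (Set.Icc 0 1 ×ˢ U) ∧ (∀ u ∈ U, H 0 u = a) ∧
      (∀ u ∈ U, H 1 u = u) ∧ (∀ t ∈ Set.Icc (0 : ℝ) 1, H t a = a) ∧
      ∀ u ∈ U, ∀ t ∈ Set.Icc (0 : ℝ) 1, ∀ t' ∈ Set.Icc (0 : ℝ) 1,
        dist (H t' u) (H t u) ≤ ρ * |t' - t| := by
  set φ := chartAt 𝔼(d) p with hφ
  have hp : p ∈ φ.source := mem_chart_source _ p
  obtain ⟨C, hC, N, hN, hCN⟩ := exists_nhds_dist_chartAt_symm_le (d := d) p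
  rw [← hφ] at hN hCN
  obtain ⟨ε₀, hε₀, hball₀⟩ := Metric.mem_nhds_iff.1
    (inter_mem hN (φ.open_target.mem_nhds (φ.map_source hp)))
  set ε := min ε₀ (ρ / (2 * C)) with hε
  have hε0 : 0 < ε := lt_min hε₀ (by positivity)
  have hball : Metric.ball (φ p) ε ⊆ N ∩ φ.target :=
    (Metric.ball_subset_ball (min_le_left _ _)).trans hball₀
  have hεC : C * (2 * ε) ≤ ρ := by
    calc C * (2 * ε) ≤ C * (2 * (ρ / (2 * C))) := by
          gcongr
          exact min_le_right _ _
      _ = ρ := by field_simp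
  set U := φ.source ∩ φ ⁻¹' Metric.ball (φ p) ε with hU
  have hUim : φ.symm '' Metric.ball (φ p) ε = U := by
    ext u
    constructor
    · rintro ⟨y, hy, rfl⟩
      refine ⟨φ.map_target (hball hy).2, ?_⟩
      rwa [Set.mem_preimage, φ.right_inv (hball hy).2]
    · rintro ⟨hu, hu'⟩
      exact ⟨φ u, hu', φ.left_inv hu⟩
  refine ⟨U, φ.isOpen_inter_preimage Metric.isOpen_ball, ⟨hp, Metric.mem_ball_self hε0⟩, ?_,
    fun a ha => ?_⟩
  · rw [← hUim]
    exact (convex_ball _ _).isPreconnected.image _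
      (φ.continuousOn_symm.mono fun y hy => (hball hy).2)
  · have hseg : ∀ t ∈ Set.Icc (0 : ℝ) 1, ∀ u ∈ U,
        AffineMap.lineMap (φ a) (φ u) t ∈ Metric.ball (φ p) ε := fun t ht u hu =>
      (convex_ball (φ p) ε).lineMap_mem ha.2 hu.2 ht
    refine ⟨fun t u => φ.symm (AffineMap.lineMap (φ a) (φ u) t), ?_, fun u hu => ?_,
      fun u hu => ?_, fun t _ => ?_, fun u hu t ht t' ht' => ?_⟩
    · refine φ.continuousOn_symm.comp (t := φ.target) ?_ fun z hz =>
        (hball (hseg z.1 hz.1 z.2 hz.2)).2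
      have h1 : ContinuousOn (fun z : ℝ × M => φ z.2) (Set.Icc 0 1 ×ˢ U) :=
        φ.continuousOn.comp continuousOn_snd fun z hz => hz.2.1
      simp only [AffineMap.lineMap_apply_module]
      exact ((continuousOn_const.sub continuousOn_fst).smul continuousOn_const).add
        (continuousOn_fst.smul h1)
    · simp [φ.left_inv ha.1]
    · simp [φ.left_inv hu.1]
    · simp [φ.left_inv ha.1]
    · refine (hCN _ (hball (hseg t' ht' u hu)).1 _ (hball (hseg t ht u hu)).1).trans ?_
      rw [dist_lineMap_lineMap, Real.dist_eq]
      have h2 : dist (φ a) (φ u) ≤ 2 * ε := by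
        have h3 := Metric.mem_ball.1 ha.2
        have h4 := Metric.mem_ball.1 hu.2
        linarith [dist_triangle_right (φ a) (φ u) (φ p)]
      calc C * (|t' - t| * dist (φ a) (φ u)) ≤ C * (|t' - t| * (2 * ε)) := by gcongr
        _ = C * (2 * ε) * |t' - t| := by ring
        _ ≤ ρ * |t' - t| := by gcongr

variable {d : ℕ} {M : Type*} [MetricSpace M] [ChartedSpace 𝔼(d) M]
  [RiemannianBundle (fun x : M => TangentSpace (𝓡 d) x)]
  [IsManifold (𝓡 d) ∞ M]
  [IsRiemannianManifold (𝓡 d) M]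

variable [CompactSpace M] {f : M → M} {S : Set M} {b q σ δ r C : ℝ}

/-- At a hyperbolic time `n` of `x`, there is an inverse branch of `f^[n]` over any neighbourhood
of `f^[n] x` that is contracted to `f^[n] x` along `r / 2`-Lipschitz paths. It follows
the orbit of `x` backwards with exponential contraction. -/
lemma exists_inverse_branch (hf : Continuous f) (hSc : IsClosed S)
    (hfS : IsLocalDiffeomorphOn (𝓡 d) (𝓡 d) 2 f Sᶜ)
    (hq : 0 < q) (hσ : σ = q ^ 4) (hr : 0 < r)
    (hctrl : ∀ (k : ℕ) (x : M), σ ^ (b * k) ≤ truncDist δ S x →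
      ∀ y : M, dist y x ≤ r * (q ^ 2) ^ k → y ∉ S ∧
        normDerivInv d f y ≤ (q ^ 2)⁻¹ * normDerivInv d f x ∧
        |Real.log (absDetDeriv d f y) - Real.log (absDetDeriv d f x)| ≤ C * q ^ k)
    {n : ℕ} {x : M} (hx : IsHyperbolicTime d f S b σ δ n x) {U : Set M} (hxU : f^[n] x ∈ U)
    {H : ℝ → M → M} (hH : ContinuousOn (fun z : ℝ × M => H z.1 z.2) (Set.Icc 0 1 ×ˢ U))
    (H0 : ∀ u ∈ U, H 0 u = f^[n] x) (H1 : ∀ u ∈ U, H 1 u = u)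
    (Hx : ∀ t ∈ Set.Icc (0 : ℝ) 1, H t (f^[n] x) = f^[n] x)
    (Hlip : ∀ u ∈ U, ∀ t ∈ Set.Icc (0 : ℝ) 1, ∀ t' ∈ Set.Icc (0 : ℝ) 1,
      dist (H t' u) (H t u) ≤ r / 2 * |t' - t|) :
    ∃ g : M → M, ContinuousOn g U ∧
      (∀ u ∈ U, (∀ k ≤ n, dist (f^[n - k] (g u)) (f^[n - k] x) ≤ r * (q ^ 2) ^ k) ∧
        f^[n] (g u) = u) ∧ g (f^[n] x) = x := by
  set K : Set M := {y | ∀ k ≤ n, dist (f^[n - k] y) (f^[n - k] x) ≤ r / 2 * (q ^ 2) ^ k} with hKdef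
  have hKc : IsCompact K := by
    have : K = ⋂ k ∈ Finset.range (n + 1),
        {y | dist (f^[n - k] y) (f^[n - k] x) ≤ r / 2 * (q ^ 2) ^ k} := by
      ext y
      simp [hKdef]
    rw [this]
    exact (isClosed_biInter fun k _ => isClosed_le
      ((hf.iterate _).dist continuous_const) continuous_const).isCompact
  have hhalf : ∀ k : ℕ, r / 2 * (q ^ 2) ^ k < r * (q ^ 2) ^ k := fun k => by
    have : 0 < (q ^ 2) ^ k := by positivity
    nlinarith
  set E : Set M := {y | ∀ i < n, f^[i] y ∈ Sᶜ} with hE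
  have hKE : K ⊆ E := fun y hy i hi => by
    have h1 := hy (n - i) (Nat.sub_le _ _)
    have h2 := (hctrl (n - i) (f^[n - (n - i)] x) (hx (n - i) (by omega) (Nat.sub_le _ _)).2 _
      (h1.trans (hhalf _).le)).1
    rwa [Nat.sub_sub_self hi.le] at h2
  have apriori : ∀ u ∈ U, ∀ T ∈ Set.Icc (0 : ℝ) 1, ∀ c : ℝ → M, ContinuousOn c (Set.Icc 0 T) →
      c 0 = x → (∀ t ∈ Set.Icc 0 T, f^[n] (c t) = H t u) → c T ∈ K := by
    intro u hu T hT c hc hc0 hcH k hk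
    have hprod : ∀ k ≤ n, ∏ i ∈ Finset.Ico (n - k) n, ((q ^ 2)⁻¹ * normDerivInv d f (f^[i] x)) ≤
        (q ^ 2) ^ k := fun k hk => by
      rcases Nat.eq_zero_or_pos k with rfl | hk0
      · simp
      · have hqσ : (q ^ 2)⁻¹ * q ^ 4 = q ^ 2 := by field_simp
        rw [Finset.prod_mul_distrib, Finset.prod_const, Nat.card_Ico, Nat.sub_sub_self hk]
        calc ((q ^ 2)⁻¹) ^ k * ∏ i ∈ Finset.Ico (n - k) n, normDerivInv d f (f^[i] x)
            ≤ ((q ^ 2)⁻¹) ^ k * σ ^ k := by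
              gcongr
              exact (hx k hk0 hk).1
          _ = (q ^ 2) ^ k := by
              rw [← mul_pow, hσ, hqσ]
    have hmain := dist_iterate_le_of_lift hf (n := n) (x := x)
      (K := fun i => (q ^ 2)⁻¹ * normDerivInv d f (f^[i] x)) (s := q ^ 2) (ρ := r / 2)
      (fun i => mul_nonneg (by positivity) (normDerivInv_nonneg f _)) (by positivity)
      (by positivity) hprod (fun k hk0 hk y hy => ?_) hT.2 (γ := fun t => H t u)
      (fun t ht t' ht' => Hlip u hu t ⟨ht.1, ht.2.trans hT.2⟩ t' ⟨ht'.1, ht'.2.trans hT.2⟩)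
      hc hc0 hcH k hk T ⟨hT.1, le_rfl⟩
    · exact hmain.trans (mul_le_of_le_one_right (by positivity) hT.2)
    · have hev : ∀ᶠ z in nhds y, dist z (f^[n - k] x) < r * (q ^ 2) ^ k :=
        (continuous_id.dist continuous_const).continuousAt.eventually_lt continuousAt_const
          (hy.trans_lt (hhalf k))
      have hxk := (hx k hk0 hk).2
      refine exists_nhds_dist_le_mul_dist (d := d) (n := 2) (by norm_num)
        (hfS ⟨y, (hctrl k _ hxk y (hy.trans (hhalf k).le)).1⟩) ?_
      filter_upwards [hev] with z hz
      exact (hctrl k _ hxk z hz.le).2.1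
  obtain ⟨g, hg, hgK, hgx⟩ := exists_continuous_section
    (isOpen_iterate_mem hf hSc.isOpen_compl n)
    (isLocalHomeomorphOn_iterate hfS.isLocalHomeomorphOn n) hKc hKE hxU hH H0 H1 Hx apriori
  exact ⟨g, hg, fun u hu => ⟨fun k hk => ((hgK u hu).1 k hk).trans (hhalf k).le,
      (hgK u hu).2⟩, hgx⟩

end InverseBranches

/-! ### Bounded distortion at hyperbolic times -/

section Distortion

lemma sum_pow_sub_le {q : ℝ} (hq : 0 < q) (hq1 : q < 1) (n : ℕ) :
    ∑ i ∈ Finset.range n, q ^ (n - i) ≤ (1 - q)⁻¹ := by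
  calc ∑ i ∈ Finset.range n, q ^ (n - i)
      ≤ ∑ i ∈ Finset.range n, q ^ (n - 1 - i) := Finset.sum_le_sum fun i _ =>
        pow_le_pow_of_le_one hq.le hq1.le (by omega)
    _ = ∑ i ∈ Finset.range n, q ^ i := Finset.sum_range_reflect _ n
    _ ≤ ∑' i, q ^ i := (summable_geometric_of_lt_one hq.le hq1).sum_le_tsum _
        fun i _ => by positivity
    _ = (1 - q)⁻¹ := tsum_geometric_of_lt_one hq.le hq1

/-- If the logarithms of the factors of two products differ by at most `C q ^ (n - i)`, then the
products are comparable with a constant that does not depend on `n`. -/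
lemma prod_le_exp_mul_prod {q C : ℝ} (hq : 0 < q) (hq1 : q < 1) (hC : 0 ≤ C) {n : ℕ}
    {a a' : ℕ → ℝ} (ha : ∀ i < n, 0 < a i) (ha' : ∀ i < n, 0 < a' i)
    (h : ∀ i < n, Real.log (a i) - Real.log (a' i) ≤ C * q ^ (n - i)) :
    ∏ i ∈ Finset.range n, a i ≤ Real.exp (C * (1 - q)⁻¹) * ∏ i ∈ Finset.range n, a' i := by
  calc ∏ i ∈ Finset.range n, a i
      ≤ ∏ i ∈ Finset.range n, Real.exp (C * q ^ (n - i)) * a' i := by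
        refine Finset.prod_le_prod (fun i hi => (ha i (Finset.mem_range.1 hi)).le) fun i hi => ?_
        rw [Finset.mem_range] at hi
        have h1 := h i hi
        rw [← Real.log_le_log_iff (ha i hi) (mul_pos (Real.exp_pos _) (ha' i hi)),
          Real.log_mul (Real.exp_pos _).ne' (ha' i hi).ne', Real.log_exp]
        linarith
    _ = Real.exp (C * ∑ i ∈ Finset.range n, q ^ (n - i)) * ∏ i ∈ Finset.range n, a' i := by
        rw [Finset.prod_mul_distrib, ← Real.exp_sum, Finset.mul_sum]
    _ ≤ Real.exp (C * (1 - q)⁻¹) * ∏ i ∈ Finset.range n, a' i := by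
        refine mul_le_mul_of_nonneg_right (Real.exp_le_exp.2
          (mul_le_mul_of_nonneg_left (sum_pow_sub_le hq hq1 n) hC))
          (Finset.prod_nonneg fun i hi => (ha' i (Finset.mem_range.1 hi)).le)

/-- A measure with a Jacobian that is almost constant on `V`: the proportion of `V` that is mapped
into `A` is at most `κ ^ 2 * m A / m (F '' V)`. -/
lemma measure_inter_preimage_mul_measure_image_le {X : Type*} [MeasurableSpace X] {m : Measure X}
    {F : X → X} {V : Set X} (hV : MeasurableSet V) {A : Set X} (hA : MeasurableSet (V ∩ F ⁻¹' A))
    {P : X → ENNReal} {a κ : ℝ} (ha : 0 < a) (hκ : 0 < κ)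
    (himg : ∀ W ⊆ V, MeasurableSet W → m (F '' W) = ∫⁻ x in W, P x ∂m)
    (hP : ∀ x ∈ V, P x ≤ ENNReal.ofReal (κ * a))
    (hP' : ∀ x ∈ V, ENNReal.ofReal (κ⁻¹ * a) ≤ P x) :
    m (V ∩ F ⁻¹' A) * m (F '' V) ≤ ENNReal.ofReal (κ ^ 2) * m A * m V := by
  have h1 : ENNReal.ofReal (κ⁻¹ * a) * m (V ∩ F ⁻¹' A) ≤ m A := by
    calc ENNReal.ofReal (κ⁻¹ * a) * m (V ∩ F ⁻¹' A)
        = ∫⁻ _ in V ∩ F ⁻¹' A, ENNReal.ofReal (κ⁻¹ * a) ∂m := (setLIntegral_const _ _).symm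
      _ ≤ ∫⁻ x in V ∩ F ⁻¹' A, P x ∂m := setLIntegral_mono' hA fun x hx => hP' x hx.1
      _ = m (F '' (V ∩ F ⁻¹' A)) := (himg _ Set.inter_subset_left hA).symm
      _ ≤ m A := measure_mono (by rintro _ ⟨x, hx, rfl⟩; exact hx.2)
  have h2 : m (F '' V) ≤ ENNReal.ofReal (κ * a) * m V := by
    calc m (F '' V) = ∫⁻ x in V, P x ∂m := himg V Set.Subset.rfl hV
      _ ≤ ∫⁻ _ in V, ENNReal.ofReal (κ * a) ∂m := setLIntegral_mono' hV hP
      _ = _ := setLIntegral_const _ _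
  have h3 : ENNReal.ofReal (κ * a) = ENNReal.ofReal (κ⁻¹ * a) * ENNReal.ofReal (κ ^ 2) := by
    rw [← ENNReal.ofReal_mul (by positivity)]
    congr 1
    field_simp
  have hpos : ENNReal.ofReal (κ⁻¹ * a) ≠ 0 := (ENNReal.ofReal_pos.2 (by positivity)).ne'
  refine (ENNReal.mul_le_mul_iff_right hpos ENNReal.ofReal_ne_top).1 ?_
  calc ENNReal.ofReal (κ⁻¹ * a) * (m (V ∩ F ⁻¹' A) * m (F '' V))
      = (ENNReal.ofReal (κ⁻¹ * a) * m (V ∩ F ⁻¹' A)) * m (F '' V) := by ring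
    _ ≤ m A * (ENNReal.ofReal (κ * a) * m V) := by gcongr
    _ = _ := by rw [h3]; ring

end Distortion

section KeyEstimate

variable {d : ℕ} {M : Type*} [MetricSpace M] [CompactSpace M]
  [MeasurableSpace M] [BorelSpace M] [ChartedSpace 𝔼(d) M]
  [RiemannianBundle (fun x : M => TangentSpace (𝓡 d) x)]
  [IsManifold (𝓡 d) ∞ M]
  [IsContMDiffRiemannianBundle (𝓡 d) ∞ 𝔼(d) (fun x : M => TangentSpace (𝓡 d) x)]
  {f : M → M} {S : Set M} {B β b q σ δ r C : ℝ}

/-- Bounded distortion on an inverse branch `g` of `f^[n]` over `U`, at a hyperbolic time `n`. -/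
lemma measure_branch_mul_le (hf : Continuous f) (hSc : IsClosed S)
    (hfS : IsLocalDiffeomorphOn (𝓡 d) (𝓡 d) 2 f Sᶜ)
    (hq : 0 < q) (hq1 : q < 1) (hr : 0 < r) (hC : 0 ≤ C)
    (hctrl : ∀ (k : ℕ) (x : M), σ ^ (b * k) ≤ truncDist δ S x →
      ∀ y : M, dist y x ≤ r * (q ^ 2) ^ k → y ∉ S ∧
        normDerivInv d f y ≤ (q ^ 2)⁻¹ * normDerivInv d f x ∧
        |Real.log (absDetDeriv d f y) - Real.log (absDetDeriv d f x)| ≤ C * q ^ k)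
    {n : ℕ} {x : M} (hx : IsHyperbolicTime d f S b σ δ n x) {U : Set M} {g : M → M}
    (hgU : IsOpen (g '' U))
    (hgx : ∀ u ∈ U, (∀ k ≤ n, dist (f^[n - k] (g u)) (f^[n - k] x) ≤ r * (q ^ 2) ^ k) ∧
        f^[n] (g u) = u) {A : Set M} (hA : MeasurableSet A) :
    lebesgue d M (g '' U ∩ f^[n] ⁻¹' A) * lebesgue d M U ≤
      ENNReal.ofReal (Real.exp (C * (1 - q)⁻¹) ^ 2) * lebesgue d M A * lebesgue d M (g '' U) := by
  have hctrl' : ∀ i < n, ∀ y, dist y (f^[i] x) ≤ r * (q ^ 2) ^ (n - i) → y ∉ S ∧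
      |Real.log (absDetDeriv d f y) - Real.log (absDetDeriv d f (f^[i] x))| ≤
        C * q ^ (n - i) := fun i hi y hy => by
    have h1 := (hx (n - i) (by omega) (Nat.sub_le _ _)).2
    rw [Nat.sub_sub_self hi.le] at h1
    exact ⟨(hctrl _ _ h1 y hy).1, (hctrl _ _ h1 y hy).2.2⟩
  have hxS : ∀ i < n, f^[i] x ∉ S := fun i hi =>
    (hctrl' i hi _ (by rw [dist_self]; positivity)).1
  have hclose : ∀ y ∈ g '' U, ∀ i < n, dist (f^[i] y) (f^[i] x) ≤ r * (q ^ 2) ^ (n - i) := by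
    rintro _ ⟨u, hu, rfl⟩ i hi
    have h1 := (hgx u hu).1 (n - i) (Nat.sub_le _ _)
    rwa [Nat.sub_sub_self hi.le] at h1
  have hyS : ∀ y ∈ g '' U, ∀ i < n, f^[i] y ∉ S := fun y hy i hi =>
    (hctrl' i hi _ (hclose y hy i hi)).1
  have hpos : ∀ y, y ∉ S → 0 < absDetDeriv d f y := fun y hy =>
    absDetDeriv_pos two_ne_zero (hfS ⟨y, hy⟩)
  have hinj : Set.InjOn f^[n] (g '' U) := by
    rintro _ ⟨u, hu, rfl⟩ _ ⟨v, hv, rfl⟩ huv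
    rw [(hgx u hu).2, (hgx v hv).2] at huv
    rw [huv]
  have himgU : f^[n] '' (g '' U) = U := by
    rw [← Set.image_comp]
    ext u
    constructor
    · rintro ⟨v, hv, rfl⟩
      rwa [Function.comp_apply, (hgx v hv).2]
    · exact fun hu => ⟨u, hu, (hgx u hu).2⟩
  have hJ := measurable_jacobian hSc hfS
  have hprod : ∀ y ∈ g '' U, ∏ i ∈ Finset.range n, jacobian d f S (f^[i] y) =
      ENNReal.ofReal (∏ i ∈ Finset.range n, absDetDeriv d f (f^[i] y)) := fun y hy => by
    rw [ENNReal.ofReal_prod_of_nonneg fun i hi =>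
      (hpos _ (hyS y hy i (Finset.mem_range.1 hi))).le]
    exact Finset.prod_congr rfl fun i hi =>
      Set.indicator_of_mem (hyS y hy i (Finset.mem_range.1 hi)) _
  have key := measure_inter_preimage_mul_measure_image_le (m := lebesgue d M) (F := f^[n])
    (V := g '' U) hgU.measurableSet (A := A)
    (hgU.measurableSet.inter ((hf.iterate n).measurable hA))
    (P := fun y => ∏ i ∈ Finset.range n, jacobian d f S (f^[i] y))
    (a := ∏ i ∈ Finset.range n, absDetDeriv d f (f^[i] x)) (κ := Real.exp (C * (1 - q)⁻¹))
    (Finset.prod_pos fun i hi => hpos _ (hxS i (Finset.mem_range.1 hi))) (Real.exp_pos _)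
    (fun W hWV hW => measure_iterate_image hf hJ
      (fun W hW hWS hi => lebesgue_image hf hSc hfS hW hWS hi) n hW
      (fun i hi y hy => hyS y (hWV hy) i hi) (hinj.mono hWV)) ?_ ?_
  · rwa [himgU] at key
  · intro y hy
    rw [hprod y hy]
    refine ENNReal.ofReal_le_ofReal (prod_le_exp_mul_prod hq hq1 hC
      (fun i hi => hpos _ (hyS y hy i hi)) (fun i hi => hpos _ (hxS i hi)) fun i hi => ?_)
    exact (abs_le.1 (hctrl' i hi _ (hclose y hy i hi)).2).2
  · intro y hy
    rw [hprod y hy]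
    refine ENNReal.ofReal_le_ofReal ?_
    rw [inv_mul_le_iff₀ (Real.exp_pos _)]
    refine prod_le_exp_mul_prod hq hq1 hC (fun i hi => hpos _ (hxS i hi))
      (fun i hi => hpos _ (hyS y hy i hi)) fun i hi => ?_
    have := (abs_le.1 (hctrl' i hi _ (hclose y hy i hi)).2).1
    linarith

variable [Nonempty M] [IsRiemannianManifold (𝓡 d) M]

/-- The push-forwards under `f^[n]` of Lebesgue measure restricted to the points for which `n` is a
hyperbolic time have densities that are bounded uniformly in `n`. -/
lemma exists_measure_hyperbolicTime_inter_preimage_le (hf : Continuous f)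
    (hS : IsCompactProperSubmanifold d S) (hfS : IsLocalDiffeomorphOn (𝓡 d) (𝓡 d) 2 f Sᶜ)
    (hnd : IsNondegenerate d f S B β) (hb0 : 0 < b) (hbβ : b < min (1 / 2) (1 / (4 * β)))
    (hσ : 0 < σ) (hσ1 : σ < 1) (hδ : 0 < δ) :
    ∃ C : ENNReal, C ≠ ⊤ ∧ ∀ (n : ℕ) (A : Set M), MeasurableSet A →
      lebesgue d M ({x | IsHyperbolicTime d f S b σ δ n x} ∩ f^[n] ⁻¹' A) ≤
        C * lebesgue d M A := by
  have hSc := hS.isCompact.isClosed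
  obtain ⟨q, hq, hq1, hqσ⟩ : ∃ q : ℝ, 0 < q ∧ q < 1 ∧ σ = q ^ 4 := by
    refine ⟨σ ^ (1 / 4 : ℝ), Real.rpow_pos_of_pos hσ _,
      Real.rpow_lt_one hσ.le hσ1 (by norm_num), ?_⟩
    rw [← Real.rpow_natCast, ← Real.rpow_mul hσ.le]
    norm_num
  have hbβ' : b * β < 1 / 4 := by
    have h1 := hbβ.trans_le (min_le_right _ _)
    have hβ := hnd.pos
    rw [lt_div_iff₀ (by positivity)] at h1
    linarith
  obtain ⟨r, hr, C, hC, hctrl⟩ := exists_uniform_control hS hfS hnd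
    (hbβ.trans_le (min_le_left _ _)) hbβ' hb0 hq hq1 hqσ hδ
  set κ := ENNReal.ofReal (Real.exp (C * (1 - q)⁻¹) ^ 2) with hκ
  choose U hUo hpU hUc hUH using fun p : M => exists_isOpen_contraction d p (half_pos hr)
  obtain ⟨t, ht⟩ := isCompact_univ.elim_finite_subcover U hUo
    (fun p _ => Set.mem_iUnion.2 ⟨p, hpU p⟩)
  have hUne : ∀ p, lebesgue d M (U p) ≠ 0 := fun p => ((hUo p).measure_pos _ ⟨p, hpU p⟩).ne'
  refine ⟨∑ p ∈ t, κ / lebesgue d M (U p), ?_, fun n A hA => ?_⟩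
  · exact ENNReal.sum_ne_top.2 fun p _ => ENNReal.div_ne_top ENNReal.ofReal_ne_top (hUne p)
  set Q := {x | IsHyperbolicTime d f S b σ δ n x} with hQ
  have hlocal : ∀ p, lebesgue d M (Q ∩ f^[n] ⁻¹' (A ∩ U p)) ≤
      κ / lebesgue d M (U p) * lebesgue d M A := fun p => by
    have hE := isOpen_iterate_mem hf hSc.isOpen_compl n
    have hF := isLocalHomeomorphOn_iterate hfS.isLocalHomeomorphOn n
    have h1 : lebesgue d M (Q ∩ f^[n] ⁻¹' (A ∩ U p)) * lebesgue d M (U p) ≤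
        κ * lebesgue d M A := by
      refine measure_inter_preimage_mul_le hE hF (hUo p) (hUc p) fun x hx hxU => ?_
      obtain ⟨H, hH, H0, H1, Hx, Hlip⟩ := hUH p _ hxU
      obtain ⟨g, hg, hgU, hgx⟩ := exists_inverse_branch hf hSc hfS hq hqσ hr hctrl hx hxU hH H0 H1
        Hx Hlip
      have hgE : ∀ u ∈ U p, g u ∈ {y | ∀ i < n, f^[i] y ∈ Sᶜ} := fun u hu i hi => by
        have h1 := (hx (n - i) (by omega) (Nat.sub_le _ _)).2
        have h2 := (hctrl _ _ h1 _ ((hgU u hu).1 (n - i) (Nat.sub_le _ _))).1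
        rwa [Nat.sub_sub_self hi.le] at h2
      have hgo := isOpen_image_section hE hF (hUo p) hg hgE fun u hu => (hgU u hu).2
      exact ⟨g, hg, hgE, fun u hu => (hgU u hu).2, hgx,
        measure_branch_mul_le hf hSc hfS hq hq1 hr hC hctrl hx hgo hgU hA⟩
    rw [ENNReal.mul_comm_div, ← mul_div_assoc,
      ENNReal.le_div_iff_mul_le (Or.inl (hUne p)) (Or.inl (measure_ne_top _ _))]
    exact h1
  calc lebesgue d M (Q ∩ f^[n] ⁻¹' A)
      ≤ lebesgue d M (⋃ p ∈ t, Q ∩ f^[n] ⁻¹' (A ∩ U p)) := by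
        refine measure_mono fun x hx => ?_
        obtain ⟨p, hp, hxp⟩ := Set.mem_iUnion₂.1 (ht (Set.mem_univ (f^[n] x)))
        exact Set.mem_biUnion hp ⟨hx.1, hx.2, hxp⟩
    _ ≤ ∑ p ∈ t, lebesgue d M (Q ∩ f^[n] ⁻¹' (A ∩ U p)) := measure_biUnion_finset_le _ _
    _ ≤ ∑ p ∈ t, κ / lebesgue d M (U p) * lebesgue d M A :=
        Finset.sum_le_sum fun p _ => hlocal p
    _ = (∑ p ∈ t, κ / lebesgue d M (U p)) * lebesgue d M A := by rw [Finset.sum_mul]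

end KeyEstimate

/-! ### Concatenation of hyperbolic times -/

section Concatenation

variable {d : ℕ} {M : Type*} [MetricSpace M] [ChartedSpace 𝔼(d) M]
  [RiemannianBundle (fun x : M => TangentSpace (𝓡 d) x)]
  {f : M → M} {S : Set M} {b σ δ : ℝ}

variable (d) in
lemma isHyperbolicTime_zero (x : M) : IsHyperbolicTime d f S b σ δ 0 x :=
  fun k hk hk' => absurd hk (by omega)

/-- A hyperbolic time `k` of `f^[n] x` that follows a hyperbolic time `n` of `x` gives the
hyperbolic time `n + k` of `x`. -/
lemma IsHyperbolicTime.add (hb : 0 < b) (hσ : 0 < σ) (hσ1 : σ < 1) {n k : ℕ} {x : M}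
    (hn : IsHyperbolicTime d f S b σ δ n x) (hk : IsHyperbolicTime d f S b σ δ k (f^[n] x)) :
    IsHyperbolicTime d f S b σ δ (n + k) x := by
  have hshift : ∀ i, ∏ j ∈ Finset.Ico (n + i) (n + k), normDerivInv d f (f^[j] x) =
      ∏ j ∈ Finset.Ico i k, normDerivInv d f (f^[j] (f^[n] x)) := fun i => by
    rw [add_comm n i, add_comm n k, ← Finset.prod_Ico_add']
    exact Finset.prod_congr rfl fun j _ => by rw [Function.iterate_add_apply]
  intro l hl hlnk
  rcases le_or_gt l k with hlk | hlk
  · have h := hk l hl hlk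
    rw [Nat.add_sub_assoc hlk, hshift]
    refine ⟨h.1, ?_⟩
    rw [add_comm n, Function.iterate_add_apply]
    exact h.2
  · have h := hn (l - k) (by omega) (by omega)
    have hidx : n + k - l = n - (l - k) := by omega
    rw [hidx]
    refine ⟨?_, le_trans ?_ h.2⟩
    · have h2 : ∏ j ∈ Finset.Ico n (n + k), normDerivInv d f (f^[j] x) ≤ σ ^ k := by
        rcases Nat.eq_zero_or_pos k with rfl | hk0
        · simp
        · have h3 := (hk k hk0 le_rfl).1
          rwa [Nat.sub_self, ← hshift, add_zero] at h3
      rw [← Finset.prod_Ico_consecutive _ (Nat.sub_le n (l - k)) (Nat.le_add_right n k)]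
      calc _ ≤ σ ^ (l - k) * σ ^ k := mul_le_mul h.1 h2
            (Finset.prod_nonneg fun _ _ => normDerivInv_nonneg f _) (by positivity)
        _ = σ ^ l := by rw [← pow_add, Nat.sub_add_cancel hlk.le]
    -- the distance condition at scale `l - k` is stronger than the one at scale `l`
    · refine Real.rpow_le_rpow_of_exponent_ge hσ hσ1.le ?_
      have : ((l - k : ℕ) : ℝ) ≤ l := by exact_mod_cast Nat.sub_le l k
      gcongr

/-- Decomposition of the orbit segment of length `j` at its last hyperbolic time. -/
lemma exists_last_hyperbolicTime (hb : 0 < b) (hσ : 0 < σ) (hσ1 : σ < 1) (j : ℕ) (x : M) :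
    ∃ n ≤ j, IsHyperbolicTime d f S b σ δ n x ∧
      ∀ i, 1 ≤ i → i ≤ j - n → ¬ IsHyperbolicTime d f S b σ δ i (f^[n] x) := by
  classical
  refine ⟨Nat.findGreatest (fun n => IsHyperbolicTime d f S b σ δ n x) j, Nat.findGreatest_le j,
    Nat.findGreatest_spec (P := fun n => IsHyperbolicTime d f S b σ δ n x) (Nat.zero_le j)
      (isHyperbolicTime_zero d x), fun i hi hij hyp => ?_⟩
  have hspec := Nat.findGreatest_spec (P := fun n => IsHyperbolicTime d f S b σ δ n x)
    (Nat.zero_le j) (isHyperbolicTime_zero d x)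
  have hle := Nat.findGreatest_le (P := fun n => IsHyperbolicTime d f S b σ δ n x) j
  exact Nat.findGreatest_is_greatest (P := fun n => IsHyperbolicTime d f S b σ δ n x)
    (k := _ + i) (Nat.lt_add_of_pos_right hi) (by omega) (hspec.add hb hσ hσ1 hyp)

variable [MeasurableSpace M]

/-- Integrability of the first hyperbolic time, in terms of the tails. -/
lemma tsum_measure_no_hyperbolicTime_ne_top {m : Measure M} [IsProbabilityMeasure m]
    (hdef : ∀ᵐ x ∂m, ∃ n : ℕ, 1 ≤ n ∧ IsHyperbolicTime d f S b σ δ n x)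
    (hint : Integrable (fun x => (firstHyperbolicTime d f S b σ δ x : ℝ)) m) :
    ∑' k : ℕ, m {x | ∀ i, 1 ≤ i → i ≤ k → ¬ IsHyperbolicTime d f S b σ δ i x} ≠ ⊤ := by
  -- the tail formula of Mathlib is stated for the canonical measure of the space
  let _ : MeasureSpace M := ⟨m⟩
  have : IsProbabilityMeasure (volume : Measure M) := ‹IsProbabilityMeasure m›
  have h := ProbabilityTheory.tsum_prob_mem_Ioi_lt_top (Ω := M) hint fun x => Nat.cast_nonneg _
  refine ne_top_of_le_ne_top h.ne (ENNReal.tsum_le_tsum fun k => measure_mono_ae ?_)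
  filter_upwards [hdef] with x hx hxk
  have hmem : firstHyperbolicTime d f S b σ δ x ∈
      {n : ℕ | 1 ≤ n ∧ IsHyperbolicTime d f S b σ δ n x} := Nat.sInf_mem hx
  have hlt : k < firstHyperbolicTime d f S b σ δ x := by
    by_contra! hle
    exact hxk _ hmem.1 hle hmem.2
  exact (Nat.cast_lt (α := ℝ)).2 hlt

end Concatenation

end HyperbolicTimes

theorem theoremB {d : ℕ} {M : Type*} [MetricSpace M] [CompactSpace M] [Nonempty M]
    [MeasurableSpace M] [BorelSpace M]
    [ChartedSpace (EuclideanSpace ℝ (Fin d)) M] [IsManifold (𝓡 d) ∞ M]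
    [RiemannianBundle (fun x : M => TangentSpace (𝓡 d) x)]
    [IsContMDiffRiemannianBundle (𝓡 d) ∞ (EuclideanSpace ℝ (Fin d))
      (fun x : M => TangentSpace (𝓡 d) x)]
    [IsRiemannianManifold (𝓡 d) M]
    (f : M → M) (S : Set M) (B β b σ δ : ℝ)
    (hf : Continuous f)
    (hS : HyperbolicTimes.IsCompactProperSubmanifold d S)
    (hfS : IsLocalDiffeomorphOn (𝓡 d) (𝓡 d) 2 f Sᶜ)
    (hnd : HyperbolicTimes.IsNondegenerate d f S B β)
    (hb : 0 < b) (hbβ : b < min (1 / 2) (1 / (4 * β)))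
    (hσ : 0 < σ) (hσ1 : σ < 1) (hδ : 0 < δ)
    (hdef : ∀ᵐ x ∂(HyperbolicTimes.lebesgue d M),
      ∃ n : ℕ, 1 ≤ n ∧ HyperbolicTimes.IsHyperbolicTime d f S b σ δ n x)
    (hint : Integrable (fun x => (HyperbolicTimes.firstHyperbolicTime d f S b σ δ x : ℝ))
      (HyperbolicTimes.lebesgue d M)) :
    (∃ μ : Measure M, IsProbabilityMeasure μ ∧ MeasurePreserving f μ μ ∧
      μ.AbsolutelyContinuous (HyperbolicTimes.lebesgue d M)) ∧
    ∀ μ : Measure M, IsFiniteMeasure μ →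
      HyperbolicTimes.IsWeakStarAccumulationPoint
        (HyperbolicTimes.averagedPushforward f (HyperbolicTimes.lebesgue d M)) μ →
      μ.AbsolutelyContinuous (HyperbolicTimes.lebesgue d M) := by
  obtain ⟨C, hC, hKE⟩ := HyperbolicTimes.exists_measure_hyperbolicTime_inter_preimage_le hf hS hfS
    hnd hb hbβ hσ hσ1 hδ
  obtain ⟨θ, hθfin, hθ, hle⟩ := HyperbolicTimes.exists_finite_dominating_measure hf.measurable
    (HyperbolicTimes.map_lebesgue_absolutelyContinuous hf hS hfS)
    (fun n => {x | HyperbolicTimes.IsHyperbolicTime d f S b σ δ n x})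
    (fun k => {x | ∀ i, 1 ≤ i → i ≤ k → ¬ HyperbolicTimes.IsHyperbolicTime d f S b σ δ i x})
    (HyperbolicTimes.exists_last_hyperbolicTime hb hσ hσ1) hC hKE
    (HyperbolicTimes.tsum_measure_no_hyperbolicTime_ne_top hdef hint)
  refine ⟨?_, fun μ hμ hacc => ?_⟩
  · obtain ⟨μ, hμ, hinv, hac⟩ := HyperbolicTimes.exists_invariant_of_map_iterate_le hf hle
    exact ⟨μ, hμ, hinv, hac.trans hθ⟩
  · obtain ⟨φ, -, hφ⟩ := hacc
    exact (HyperbolicTimes.absolutelyContinuous_of_tendsto_integral (l := atTop)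
      (Eventually.of_forall fun k => HyperbolicTimes.averagedPushforward_le hle (φ k)) hφ).trans hθ
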